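/- Let $G=(\mathcal V,\mathcal E)$ be a finite connected graph without loops or multiple edges, with $n=|\mathcal V|$, symmetric edge weights $w_{xy}=w_{yx}>0$ for $x\sim y$, and a $\mathrm U(1)$-connection: unit complex numbers $\phi_{xy}$ with $\phi_{yx}=\overline{\phi_{xy}}$ for $x\sim y$. Let $\mathsf W_{xy}=w_{xy}$ and $\mathsf\Phi_{xy}=\phi_{xy}$ if $x\sim y$ and $0$ otherwise, $\deg(x)=\sum_{y\sim x}w_{xy}$, $\mathsf D=\mathrm{diag}(\deg(x))_{x\in\mathcal V}$, and $\mathsf\Delta=\mathsf D-\mathsf W\odot\mathsf\Phi$, where $\odot$ is the entrywise product. An oriented cycle is a closed path $c=(x_0,x_1,\dots,x_{k-1},x_0)$ in $G$ with $k\ge 2$ and $x_0,\dots,x_{k-1}$ distinct; its holonomy is $\mathrm{hol}(c)=\phi_{x_0x_1}\cdots\phi_{x_{k-1}x_0}=e^{-\mathrm i\theta(c)}$. Assume that $\mathrm{hol}(c)\neq1$ for at least one cycle $c$, and that $\cos\theta(c)\ge0$ for all cycles $c$. Let $q>0$, and let $G_r$ be the graph obtained from $G$ by joining every vertex to a new vertex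 $r$ by an edge of weight $q$. Fix an ordering of $\mathcal V$. The algorithm $\textsc{CyclePopping}_q$ (which samples a multi-type spanning forest of $G$) grows a subgraph of $G_r$, starting from the single vertex $r$, as follows. While some vertex is not in the current subgraph, start at the first such vertex $x_0$ (in the ordering) a random walk on $G_r$ which goes from $x$ to a neighbour with probability proportional to the weight of the edge, and keep track of its loop-erased path. When the walk hits the current subgraph, stop it and add the path to the subgraph. When a step of the walk closes an oriented cycle $c$ of the path, then, independently of everything else, with probability $1-\cos\theta(c)$ accept $c$, stop the walk and add the path together with the cycle to the subgraph; otherwise erase $c$ from the path and continue the walk. When all vertices are in the subgraph, remove $r$ and its edges, and stop. Let $T$ be the running time, i.e. the total number of steps made by these random walks. Then $T$ is almost surely finite and has a finite second moment, the matrices $\mathsf D+q\mathbb I$, $\mathsf\Delta+q\mathbb I$ and $\mathbb I-\mathsf M$, with $\mathsf M=(\mathsf D+q\mathbb I)^{-1}(\mathsf W\odot\mathsf\Phi)$, are invertible, and $$\mathbb E[T]=\mathrm{Tr}\left((\mathsf D+q\mathbb I)(\mathsf\Delta+q\mathbb I)^{-1}\right),$$ $$\mathrm{var}[T]=\mathrm{Tr}\left(\mathsf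 M(\mathbb I-\mathsf M)^{-1}\right)+\mathrm{Tr}\left(\left(\mathsf M(\mathbb I-\mathsf M)^{-1}\right)^2\right).$$ -/

import Mathlib

open scoped Matrix

/-- A finite connected weighted graph (no loops, no multiple edges) with positive symmetric edge
weights and a `U(1)`-connection on its oriented edges. The weight is extended by `0` off the edges;
the connection has no meaning off the edges. -/
structure ConnectionGraph (V : Type*) where
  /-- the underlying simple graph -/
  graph : SimpleGraph V
  connected : graph.Connected
  /-- the edge weights `w_{xy}` -/
  weight : V → V → ℝ
  weight_symm : ∀ x y, weight x y = weight y x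
  weight_pos : ∀ x y, graph.Adj x y → 0 < weight x y
  weight_eq_zero : ∀ x y, ¬ graph.Adj x y → weight x y = 0
  /-- the unit complex numbers `φ_{xy}` -/
  phase : V → V → Circle
  phase_symm : ∀ x y, graph.Adj x y → phase y x = (phase x y)⁻¹

namespace ConnectionGraph

theorem weight_nonneg {V : Type*} (G : ConnectionGraph V) (x y : V) : 0 ≤ G.weight x y := by
  by_cases h : G.graph.Adj x y
  · exact (G.weight_pos x y h).le
  · exact (G.weight_eq_zero x y h).ge

/-- An oriented cycle, given by its vertices `[x₀, …, x_{k-1}]`, `k ≥ 2`, which are distinct and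
such that `x₀ ∼ x₁ ∼ ⋯ ∼ x_{k-1} ∼ x₀`. Backtracks (`k = 2`) are included. -/
def IsOrientedCycle {V : Type*} (G : ConnectionGraph V) (c : List V) : Prop :=
  2 ≤ c.length ∧ c.Nodup ∧ ∀ e ∈ c.zip (c.rotate 1), G.graph.Adj e.1 e.2

/-- The holonomy `φ_{x₀x₁} ⋯ φ_{x_{k-1}x₀} = exp (-i θ(c))` of the closed path with vertices
`c = [x₀, …, x_{k-1}]`. -/
noncomputable def holonomy {V : Type*} (G : ConnectionGraph V) (c : List V) : Circle :=
  ((c.zip (c.rotate 1)).map fun e => G.phase e.1 e.2).prod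

/-- `cos θ(c)`, the real part of the holonomy `exp (-i θ(c))`. -/
noncomputable def cosTheta {V : Type*} (G : ConnectionGraph V) (c : List V) : ℝ :=
  (G.holonomy c : ℂ).re

/-- The connection is non-trivial: some cycle has holonomy different from `1`. -/
def NonTrivial {V : Type*} (G : ConnectionGraph V) : Prop :=
  ∃ c : List V, G.IsOrientedCycle c ∧ G.holonomy c ≠ 1

/-- All cycles are weakly inconsistent: `cos θ(c) ≥ 0`. -/
def WeaklyInconsistent {V : Type*} (G : ConnectionGraph V) : Prop :=
  ∀ c : List V, G.IsOrientedCycle c → 0 ≤ G.cosTheta c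

/-! ### Matrices -/

section Matrices

variable {V : Type*} [Fintype V]

/-- The weighted degree `deg x = ∑_{y ∼ x} w_{xy}`. -/
def deg (G : ConnectionGraph V) (x : V) : ℝ := ∑ y, G.weight x y

/-- The weight matrix `W`. -/
def W (G : ConnectionGraph V) : Matrix V V ℂ := Matrix.of fun x y => (G.weight x y : ℂ)

open Classical in
/-- The matrix `Φ` of the connection. -/
noncomputable def Φ (G : ConnectionGraph V) : Matrix V V ℂ :=
  Matrix.of fun x y => if G.graph.Adj x y then (G.phase x y : ℂ) else 0

/-- The degree matrix `D`. -/
def D [DecidableEq V] (G : ConnectionGraph V) : Matrix V V ℂ :=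
  Matrix.diagonal fun x => (G.deg x : ℂ)

/-- The magnetic Laplacian `Δ = D - W ⊙ Φ`. -/
noncomputable def Δ [DecidableEq V] (G : ConnectionGraph V) : Matrix V V ℂ := G.D - G.W ⊙ G.Φ

/-- The matrix `M = (D + qI)⁻¹ (W ⊙ Φ)`. -/
noncomputable def M [DecidableEq V] (G : ConnectionGraph V) (q : ℝ) : Matrix V V ℂ :=
  (G.D + (q : ℂ) • (1 : Matrix V V ℂ))⁻¹ * (G.W ⊙ G.Φ)

theorem deg_nonneg (G : ConnectionGraph V) (x : V) : 0 ≤ G.deg x :=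
  Finset.sum_nonneg fun y _ => G.weight_nonneg x y

end Matrices

/-! ### The random walk on the auxiliary graph

The auxiliary graph has vertex set `Option V`: `none` is the root `r`, and `some x`, for `x : V`,
is joined to `r` by an edge of weight `q`. -/

section Walk

variable {V : Type*} [Fintype V]

/-- Weight of the edge of the auxiliary graph from `x : V` to a vertex of the auxiliary graph. -/
def auxWeight (G : ConnectionGraph V) (q : ℝ) (x : V) : Option V → ℝ
  | none => q
  | some y => G.weight x y

/-- One step of the simple random walk on the auxiliary graph from `x : V`: a neighbour of `x` is
drawn with probability proportional to the weight of the edge leading to it. -/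
noncomputable def srw (G : ConnectionGraph V) (q : ℝ) (hq : 0 < q) (x : V) : PMF (Option V) :=
  PMF.ofFintype (fun y => ENNReal.ofReal (G.auxWeight q x y / (G.deg x + q))) (by
    have hd : 0 < G.deg x + q := add_pos_of_nonneg_of_pos (G.deg_nonneg x) hq
    rw [← ENNReal.ofReal_sum_of_nonneg, ← Finset.sum_div]
    · rw [Fintype.sum_option]
      simp only [auxWeight]
      rw [add_comm, show (∑ y, G.weight x y) = G.deg x from rfl, div_self hd.ne',
        ENNReal.ofReal_one]
    · intro y _
      refine div_nonneg ?_ hd.le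
      cases y with
      | none => exact hq.le
      | some y => exact G.weight_nonneg x y)

end Walk

/-- The Bernoulli law with success probability `p`. -/
noncomputable def coin (p : unitInterval) : PMF Bool :=
  PMF.ofFintype (fun b => if b then ENNReal.ofReal (p : ℝ) else ENNReal.ofReal (1 - (p : ℝ))) (by
    rw [Fintype.sum_bool]
    simp only [if_true, Bool.false_eq_true, if_false]
    rw [← ENNReal.ofReal_add p.2.1 (sub_nonneg.2 p.2.2)]
    simp)

/-- The probability `α(c) = 1 - cos θ(c)` that the cycle `c` is accepted. The projection onto
`[0, 1]` does nothing on cycles with `cos θ(c) ≥ 0`, see `coe_acceptProb`. -/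
noncomputable def acceptProb {V : Type*} (G : ConnectionGraph V) (c : List V) : unitInterval :=
  Set.projIcc (0 : ℝ) 1 zero_le_one (1 - G.cosTheta c)

theorem coe_acceptProb {V : Type*} (G : ConnectionGraph V) (c : List V) (h : 0 ≤ G.cosTheta c) :
    (G.acceptProb c : ℝ) = 1 - G.cosTheta c := by
  have h1 : G.cosTheta c ≤ 1 :=
    (Complex.re_le_norm _).trans (Circle.norm_coe (G.holonomy c)).le
  have h2 : 1 - G.cosTheta c ∈ Set.Icc (0 : ℝ) 1 := ⟨by linarith, by linarith⟩
  simp [acceptProb, Set.projIcc_of_mem _ h2]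

/-! ### The algorithm -/

/-- A state of the algorithm.
* `nodes` and `edges` are the node set and the set of oriented edges of the subgraph `𝒯_ℓ` of the
  auxiliary graph that has been built so far (every edge starts at a vertex of `G`);
* `path = [x₀, …, x_k]` is the loop-erased trajectory of the current walk, which started at `x₀`
  and is now at `x_k`; it is empty when the algorithm has finished. -/
structure State (V : Type*) where
  nodes : Finset (Option V)
  edges : Finset (V × Option V)
  path : List V

/-- The algorithm stops when the subgraph built so far contains all nodes. -/
def State.IsDone {V : Type*} (s : State V) : Prop := ∀ x : Option V, x ∈ s.nodes

section Algorithm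

variable {V : Type*} [Fintype V] [DecidableEq V]

/-- Start a new walk, after the subgraph `(nodes, edges)` has been built, at the first vertex in the
ordering `ι` that is not in `nodes`. If there is no such vertex, the path is left empty. -/
def start (ι : Fin (Fintype.card V) ≃ V) (nodes : Finset (Option V))
    (edges : Finset (V × Option V)) : State V where
  nodes := nodes
  edges := edges
  path := (((List.finRange (Fintype.card V)).map ι).find? fun x => decide (some x ∉ nodes)).toList

/-- The initial state: the subgraph `{r}`, and a walk that starts at the first vertex. -/
def init (ι : Fin (Fintype.card V) ≃ V) : State V := start ι {none} ∅

/-- Add to the subgraph the branch or lasso `x₀ → x₁ → ⋯ → x_k → y`, where `[x₀, …, x_k]` is the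
current path, and start a new walk. -/
def attach (ι : Fin (Fintype.card V) ≃ V) (s : State V) (y : Option V) : State V :=
  start ι (s.nodes ∪ (s.path.map some).toFinset)
    (s.edges ∪ (s.path.zip ((s.path.map some).tail ++ [y])).toFinset)

/-- One step of the algorithm, i.e. one step of the random walk, from `x = x_k` to a random
neighbour `y` in the auxiliary graph, followed by the update of the state.
* If the walk hits the subgraph built so far (in particular if `y` is the root), the path from `x₀`
  to `y` is added to it as a branch.
* Otherwise, if the step closes an oriented cycle `c = [v = x_j, …, x_k]` of the path, then `c` is
  accepted with probability `α(c)`, independently of everything else, and the lasso is added to the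
  subgraph; if `c` is not accepted, it is popped (erased from the path), and the walk goes on from
  `v`.
* Otherwise, the path is extended.

Nothing happens any more when the algorithm has finished. -/
noncomputable def step (G : ConnectionGraph V) (q : ℝ) (hq : 0 < q)
    (ι : Fin (Fintype.card V) ≃ V) (s : State V) : PMF (State V) :=
  match s.path.getLast? with
  | none => PMF.pure s
  | some x => (G.srw q hq x).bind fun y =>
      if y ∈ s.nodes then PMF.pure (attach ι s y)
      else
        match y with
        | none => PMF.pure (attach ι s none)
        | some v =>
          if v ∈ s.path then
            (coin (G.acceptProb (s.path.dropWhile fun z => decide (z ≠ v)))).bind fun accepted =>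
              if accepted then PMF.pure (attach ι s (some v))
              else PMF.pure
                { s with path := (s.path.takeWhile fun z => decide (z ≠ v)) ++ [v] }
          else PMF.pure { s with path := s.path ++ [v] }

end Algorithm

/-- `X` is a (time-homogeneous) Markov chain on the countable state space `S` that starts at `s₀`
and has transition probabilities `κ`. -/
structure IsMarkovChain {Ω S : Type*} [MeasurableSpace Ω] [DecidableEq S]
    (P : MeasureTheory.Measure Ω) (κ : S → PMF S) (s₀ : S) (X : ℕ → Ω → S) : Prop where
  measurableSet_eq : ∀ (n : ℕ) (s : S), MeasurableSet {ω | X n ω = s}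
  prob_path : ∀ (n : ℕ) (s : ℕ → S), P {ω | ∀ k ≤ n, X k ω = s k} =
    (if s 0 = s₀ then 1 else 0) * ∏ k ∈ Finset.range n, κ (s k) (s (k + 1))

open Classical in
/-- `X` is a run of the algorithm `CyclePopping_q` on `G`, with ordering `ι` of the vertices: it
starts from the subgraph `{r}` and performs the successive steps of the algorithm, each of them
with fresh randomness. -/
def IsCyclePoppingRun {V Ω : Type*} [Fintype V] [DecidableEq V] [MeasurableSpace Ω]
    (P : MeasureTheory.Measure Ω) (G : ConnectionGraph V) (q : ℝ) (hq : 0 < q)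
    (ι : Fin (Fintype.card V) ≃ V) (X : ℕ → Ω → State V) : Prop :=
  IsMarkovChain P (G.step q hq ι) (init ι) X

/-- The running time `T`: the number of steps of the random walks until the algorithm stops
(with value `0` for a run that does not stop). -/
noncomputable def runningTime {V Ω : Type*} (X : ℕ → Ω → State V) (ω : Ω) : ℕ :=
  sInf {k : ℕ | (X k ω).IsDone}

end ConnectionGraph

/-! When the algorithm stops, every vertex of `G` has exactly one outgoing edge in the subgraph. So
n of the steps are kept, and all the others lie in popped cycles. A cycle is popped with weight cos
θ(c) times its transition probabilities. A cycle and its reversal have the same product of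
transition probabilities and conjugate holonomies, so det(I - zM) is a signed sum over families of
disjoint cycles with exactly these weights. Heaps of cycles then suggest E[z^T] = z^n det(I - M) /
det(I - zM).

The proof guesses and verifies. For every state, `startValue` and `pathValue` give a candidate for
the generating function of the remaining time. It is built from determinants of I - zM restricted to
a vertex set S, and from adjugate entries (x, v) with v outside S, which, divided by the
determinant, sum the weights of the walks from x in S that exit at v. Deleting a vertex from S
(`det_rowRestrict_erase`, `adjugate_rowRestrict_erase`) amounts to a first-step decomposition, and
`pathValue_step` deduces the one-step equation of the chain. The candidates tend to 1 as z tends to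
1, so by `hittingTime_generatingFunction` they are the generating functions near z = 1; the same
argument yields almost sure termination with an exponential tail.

Finally M is similar to a Hermitian matrix, hence diagonalizable with real eigenvalues e_x, and
E[z^T] = ∏ z(1 - e_x)/(1 - z e_x). Differentiating the logarithm at z = e^t, t = 0
(`moments_of_generatingFunction`) gives the mean ∑ 1/(1 - e_x) and the variance ∑ e_x/(1 - e_x)²,
which are the stated traces. -/

set_option linter.unusedSectionVars false

/-! ### Determinants and adjugates of I - M restricted to a set of rows. -/

namespace Matrix

variable {V : Type*} [Fintype V] [DecidableEq V]

/-- The identity matrix minus the rows of `M` that are indexed by `S`. -/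
def rowRestrict {R : Type*} [CommRing R] (M : Matrix V V R) (S : Finset V) : Matrix V V R :=
  Matrix.of fun x y => (1 : Matrix V V R) x y - if x ∈ S then M x y else 0

section

variable {R : Type*} [CommRing R] (M : Matrix V V R)

theorem rowRestrict_row_of_notMem {S : Finset V} {x : V} (hx : x ∉ S) :
    rowRestrict M S x = Pi.single x 1 := by
  ext y
  simp [rowRestrict, hx, Matrix.one_apply, Pi.single_apply, eq_comm]

theorem adjugate_rowRestrict_apply_of_notMem {S : Finset V} {x y : V} (hx : x ∉ S) :
    (rowRestrict M S).adjugate x y = if x = y then (rowRestrict M S).det else 0 := by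
  have h := congrFun (congrFun (Matrix.mul_adjugate (rowRestrict M S)) x) y
  rw [Matrix.mul_apply] at h
  simp only [rowRestrict_row_of_notMem M hx, Pi.single_apply, ite_mul, one_mul, zero_mul,
    Finset.sum_ite_eq', Finset.mem_univ, if_true] at h
  simpa [Matrix.one_apply] using h

theorem rowRestrict_eq_updateRow {S : Finset V} {x : V} (hx : x ∈ S) :
    rowRestrict M S =
      (rowRestrict M (S.erase x)).updateRow x (Pi.single x 1 - M x) := by
  ext u y
  by_cases hu : u = x
  · subst hu
    simp [rowRestrict, hx, Matrix.one_apply, Pi.single_apply, eq_comm]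
  · simp [rowRestrict, hu, Matrix.updateRow_ne]

theorem det_updateRow_eq_sum_adjugate (A : Matrix V V R) (x : V) (r : V → R) :
    (A.updateRow x r).det = ∑ y, r y * A.adjugate y x := by
  have h := congrFun (Matrix.mul_adjugate (A.updateRow x r)) x
  have h2 : ∀ y, (A.updateRow x r).adjugate y x = A.adjugate y x := fun y => by
    rw [Matrix.adjugate_apply, Matrix.adjugate_apply, Matrix.updateRow_idem]
  have h3 := congrFun h x
  rw [Matrix.mul_apply] at h3
  simpa [h2] using h3.symm

/-- Expansion along row x, the only row that changes. The sum collects a first step from x followed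
by a walk in `S.erase x` back to x. -/
theorem det_rowRestrict_erase {S : Finset V} {x : V} (hx : x ∈ S) :
    (rowRestrict M S).det = (rowRestrict M (S.erase x)).det -
      ∑ y, M x y * (rowRestrict M (S.erase x)).adjugate y x := by
  rw [rowRestrict_eq_updateRow M hx, det_updateRow_eq_sum_adjugate]
  simp only [Pi.sub_apply, sub_mul, Finset.sum_sub_distrib, Pi.single_apply, ite_mul, one_mul,
    zero_mul, Finset.sum_ite_eq', Finset.mem_univ, if_true]
  rw [adjugate_rowRestrict_apply_of_notMem M (Finset.notMem_erase x S), if_pos rfl]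

/-- A walk from x to its exit j is split at its last departure from x; the earlier returns to x are
absorbed by the change of determinant. The summand y = j is the direct exit. -/
theorem adjugate_rowRestrict_erase {S : Finset V} {x j : V} (hx : x ∈ S) (hj : j ∉ S) :
    (rowRestrict M S).adjugate x j =
      ∑ y, M x y * (rowRestrict M (S.erase x)).adjugate y j := by
  have hxj : x ≠ j := fun h => hj (h ▸ hx)
  have hxe : x ∉ S.erase x := Finset.notMem_erase x S
  set A := rowRestrict M (S.erase x) with hA
  rw [rowRestrict_eq_updateRow M hx, Matrix.adjugate_apply, ← hA, Matrix.updateRow_comm _ hxj,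
    det_updateRow_eq_sum_adjugate]
  have key : ∀ y, (A.updateRow j (Pi.single x 1)).adjugate y x =
      if y = x then 0 else - A.adjugate y j := by
    intro y
    rw [Matrix.adjugate_apply, Matrix.adjugate_apply]
    split_ifs with h
    · subst h
      exact Matrix.det_zero_of_row_eq hxj (by
        rw [Matrix.updateRow_self, Matrix.updateRow_ne hxj.symm, Matrix.updateRow_self])
    -- Row x of A is already the unit vector at x, so the two matrices differ by exchanging the rows
    -- x and j: this is the minus sign.
    · have hs := Matrix.det_permute (Equiv.swap x j) (A.updateRow j (Pi.single y 1))
      rw [Equiv.Perm.sign_swap hxj] at hs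
      rw [← neg_eq_iff_eq_neg]
      have hm : ((A.updateRow j (Pi.single y 1)).submatrix (Equiv.swap x j) id) =
          (A.updateRow j (Pi.single x 1)).updateRow x (Pi.single y 1) := by
        ext u w
        rw [Matrix.submatrix_apply, id]
        by_cases h1 : u = x
        · subst h1; simp
        · by_cases h2 : u = j
          · subst h2
            rw [Equiv.swap_apply_right, Matrix.updateRow_ne hxj, Matrix.updateRow_ne h1,
              Matrix.updateRow_self, hA, rowRestrict_row_of_notMem M hxe]
          · rw [Equiv.swap_apply_of_ne_of_ne h1 h2, Matrix.updateRow_ne h2,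
              Matrix.updateRow_ne h1, Matrix.updateRow_ne h2]
      rw [← hm, hs]
      simp
  have hadj : A.adjugate x j = 0 := by
    rw [hA, adjugate_rowRestrict_apply_of_notMem M hxe, if_neg hxj]
  refine Finset.sum_congr rfl fun y _ => ?_
  rw [key]
  split_ifs with h
  · subst h; simp [hadj]
  · simp [h]

end

theorem rowRestrict_univ {R : Type*} [CommRing R] (M : Matrix V V R) :
    rowRestrict M Finset.univ = 1 - M := by
  ext; simp [rowRestrict]

theorem rowRestrict_empty {R : Type*} [CommRing R] (M : Matrix V V R) :
    rowRestrict M ∅ = 1 := by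
  ext; simp [rowRestrict]

/-- Conjugate transposition exchanges the two factors in 1 - D_S H, which does not affect the
determinant. Reality of these determinants is what allows holonomies to be replaced by cosines. -/
theorem star_det_rowRestrict_diagonal_mul (d : V → ℝ) (H : Matrix V V ℂ) (hH : H.IsHermitian)
    (S : Finset V) :
    star (rowRestrict (Matrix.diagonal (fun x => (d x : ℂ)) * H) S).det =
      (rowRestrict (Matrix.diagonal (fun x => (d x : ℂ)) * H) S).det := by
  have h1 : rowRestrict (Matrix.diagonal (fun x => (d x : ℂ)) * H) S =
      1 - Matrix.diagonal (fun x => if x ∈ S then (d x : ℂ) else 0) * H := by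
    ext x y
    simp [rowRestrict, Matrix.diagonal_mul]
  have h2 : (Matrix.diagonal (fun x => if x ∈ S then (d x : ℂ) else 0))ᴴ =
      Matrix.diagonal (fun x => if x ∈ S then (d x : ℂ) else 0) := by
    rw [Matrix.diagonal_conjTranspose]
    congr 1
    ext x
    by_cases hx : x ∈ S <;> simp [hx]
  rw [h1, ← Matrix.det_conjTranspose, Matrix.conjTranspose_sub, Matrix.conjTranspose_one,
    Matrix.conjTranspose_mul, h2, hH.eq, Matrix.det_one_sub_mul_comm]

end Matrix

/-! ### Candidate generating functions along a path and their one-step equation. -/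

namespace ConnectionGraph

variable {V : Type*} [Fintype V]

/-- The probability that the random walk on the auxiliary graph goes from `x` to `y`. -/
noncomputable def transProb (G : ConnectionGraph V) (q : ℝ) (x y : V) : ℝ :=
  G.weight x y / (G.deg x + q)

theorem deg_add_pos (G : ConnectionGraph V) {q : ℝ} (hq : 0 < q) (x : V) : 0 < G.deg x + q :=
  add_pos_of_nonneg_of_pos (G.deg_nonneg x) hq

theorem transProb_nonneg (G : ConnectionGraph V) {q : ℝ} (hq : 0 < q) (x y : V) :
    0 ≤ G.transProb q x y :=
  div_nonneg (G.weight_nonneg x y) (G.deg_add_pos hq x).le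

theorem transProb_self (G : ConnectionGraph V) (q : ℝ) (x : V) : G.transProb q x x = 0 := by
  rw [transProb, G.weight_eq_zero x x (G.graph.irrefl), zero_div]

theorem sum_transProb (G : ConnectionGraph V) {q : ℝ} (hq : 0 < q) (x : V) :
    ∑ y, G.transProb q x y = 1 - q / (G.deg x + q) := by
  have := (G.deg_add_pos hq x).ne'
  simp only [transProb]
  rw [← Finset.sum_div, ← deg]
  field_simp
  ring

variable [DecidableEq V]

theorem W_hadamard_Φ_apply (G : ConnectionGraph V) (x y : V) :
    (G.W ⊙ G.Φ) x y = (G.weight x y : ℂ) * G.phase x y := by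
  by_cases h : G.graph.Adj x y
  · simp [W, Φ, h]
  · simp [W, Φ, h, G.weight_eq_zero x y h]

theorem isHermitian_W_hadamard_Φ (G : ConnectionGraph V) : (G.W ⊙ G.Φ).IsHermitian := by
  ext x y
  rw [Matrix.conjTranspose_apply, W_hadamard_Φ_apply, W_hadamard_Φ_apply, G.weight_symm y x]
  by_cases h : G.graph.Adj x y
  · rw [G.phase_symm x y h]
    simp [← Circle.coe_inv_eq_conj]
  · simp [G.weight_eq_zero x y h]

theorem D_add_smul_one (G : ConnectionGraph V) (q : ℝ) :
    G.D + (q : ℂ) • (1 : Matrix V V ℂ) =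
      Matrix.diagonal fun x => ((G.deg x + q : ℝ) : ℂ) := by
  ext x y
  by_cases h : x = y
  · subst h; simp [D]
  · simp [D, h]

theorem inv_D_add_smul_one (G : ConnectionGraph V) {q : ℝ} (hq : 0 < q) :
    (G.D + (q : ℂ) • (1 : Matrix V V ℂ))⁻¹ =
      Matrix.diagonal fun x => (((G.deg x + q)⁻¹ : ℝ) : ℂ) := by
  refine Matrix.inv_eq_left_inv ?_
  rw [D_add_smul_one, Matrix.diagonal_mul_diagonal, ← Matrix.diagonal_one]
  congr 1
  ext x
  rw [← Complex.ofReal_mul, inv_mul_cancel₀ (G.deg_add_pos hq x).ne', Complex.ofReal_one]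

theorem isUnit_D_add_smul_one (G : ConnectionGraph V) {q : ℝ} (hq : 0 < q) :
    IsUnit (G.D + (q : ℂ) • (1 : Matrix V V ℂ)) := by
  rw [Matrix.isUnit_iff_isUnit_det, D_add_smul_one, Matrix.det_diagonal, isUnit_iff_ne_zero,
    Finset.prod_ne_zero_iff]
  exact fun x _ => Complex.ofReal_ne_zero.2 (G.deg_add_pos hq x).ne'

theorem M_apply (G : ConnectionGraph V) {q : ℝ} (hq : 0 < q) (x y : V) :
    G.M q x y = (G.transProb q x y : ℂ) * G.phase x y := by
  rw [M, inv_D_add_smul_one G hq, Matrix.diagonal_mul, W_hadamard_Φ_apply, transProb]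
  push_cast
  ring

/-- The matrix `I - zM` in which the rows outside `S` are those of the identity. -/
noncomputable def popMatrix (G : ConnectionGraph V) (q z : ℝ) (S : Finset V) : Matrix V V ℂ :=
  Matrix.rowRestrict ((z : ℂ) • G.M q) S

/-- The determinant of `I - zM` on `S`. -/
noncomputable def popDet (G : ConnectionGraph V) (q z : ℝ) (S : Finset V) : ℝ :=
  (G.popMatrix q z S).det.re

theorem coe_popDet (G : ConnectionGraph V) {q : ℝ} (hq : 0 < q) (z : ℝ) (S : Finset V) :
    (G.popDet q z S : ℂ) = (G.popMatrix q z S).det := by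
  have h := Matrix.star_det_rowRestrict_diagonal_mul (fun x => z * (G.deg x + q)⁻¹)
    _ G.isHermitian_W_hadamard_Φ S
  have h2 : Matrix.diagonal (fun x => ((z * (G.deg x + q)⁻¹ : ℝ) : ℂ)) * (G.W ⊙ G.Φ) =
      (z : ℂ) • G.M q := by
    rw [M, inv_D_add_smul_one G hq, ← Matrix.smul_mul]
    congr 1
    ext x y
    by_cases h : x = y
    · subst h; simp
    · simp [h]
  rw [h2] at h
  exact Complex.conj_eq_iff_re.1 h

theorem popDet_empty (G : ConnectionGraph V) (q z : ℝ) : G.popDet q z ∅ = 1 := by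
  simp [popDet, popMatrix, Matrix.rowRestrict_empty]

/-- Strict diagonal dominance: the walk jumps to the root with probability q / (deg x + q) > 0, so
the off-diagonal moduli in a row sum to less than 1. -/
theorem popDet_one_ne_zero (G : ConnectionGraph V) {q : ℝ} (hq : 0 < q) (S : Finset V) :
    G.popDet q 1 S ≠ 0 := by
  rw [← Complex.ofReal_ne_zero, coe_popDet G hq]
  apply det_ne_zero_of_sum_row_lt_diag
  intro x
  by_cases hx : x ∈ S
  · have h1 : ‖G.popMatrix q 1 S x x‖ = 1 := by
      simp [popMatrix, Matrix.rowRestrict, hx, M_apply G hq, transProb_self]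
    have h2 : ∀ y ∈ Finset.univ.erase x, ‖G.popMatrix q 1 S x y‖ = G.transProb q x y := by
      intro y hy
      have hxy : x ≠ y := (Finset.ne_of_mem_erase hy).symm
      simp [popMatrix, Matrix.rowRestrict, hx, M_apply G hq, hxy,
        abs_of_nonneg (G.transProb_nonneg hq x y), Circle.norm_coe]
    rw [h1, Finset.sum_congr rfl h2, Finset.sum_erase _ (G.transProb_self q x),
      G.sum_transProb hq]
    have := div_pos hq (G.deg_add_pos hq x)
    linarith
  · rw [popMatrix, Matrix.rowRestrict_row_of_notMem _ hx, Finset.sum_eq_zero]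
    · simp
    · intro y hy
      simp [Finset.ne_of_mem_erase hy]

theorem continuous_popMatrix (G : ConnectionGraph V) (q : ℝ) (S : Finset V) :
    Continuous fun z => G.popMatrix q z S := by
  refine continuous_matrix fun x y => ?_
  simp only [popMatrix, Matrix.rowRestrict, Matrix.of_apply, Matrix.smul_apply, smul_eq_mul]
  split_ifs <;> fun_prop

theorem continuous_popDet (G : ConnectionGraph V) (q : ℝ) (S : Finset V) :
    Continuous fun z => G.popDet q z S :=
  Complex.continuous_re.comp (G.continuous_popMatrix q S).matrix_det

/-- The product of the phases along a path from `v` to its end. The path is given by the reversed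
list of its vertices. -/
noncomputable def arcPhase (G : ConnectionGraph V) : List V → V → ℂ
  | [], _ => 1
  | [_], _ => 1
  | x :: w :: l, v => if v = x then 1 else G.arcPhase (w :: l) v * G.phase w x

theorem arcPhase_cons_self (G : ConnectionGraph V) (x : V) (l : List V) :
    G.arcPhase (x :: l) x = 1 := by
  cases l <;> simp [arcPhase]

theorem arcPhase_cons_cons (G : ConnectionGraph V) {v y : V} (hv : v ≠ y) (x : V) (l : List V) :
    G.arcPhase (y :: x :: l) v = G.arcPhase (x :: l) v * G.phase x y := by
  simp [arcPhase, hv]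

/-- The weight of the excursions in `S` of the walk that go from the end `x` of the path back to its
vertex `v`, with the real part of the holonomy of the cycle that is closed. The reversed list of
the vertices of the path is `x :: l`. -/
noncomputable def returnWeight (G : ConnectionGraph V) (q z : ℝ) (S : Finset V) (x : V)
    (l : List V) (v : V) : ℝ :=
  (G.arcPhase (x :: l) v * (G.popMatrix q z S).adjugate x v).re

/-- The list `l` is arbitrary, since the phase from x to its successor y does not see the path
before x. -/
theorem popDet_erase (G : ConnectionGraph V) {q : ℝ} (hq : 0 < q) (z : ℝ) {S : Finset V} {x : V}
    (hx : x ∈ S) (l : List V) :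
    G.popDet q z S = G.popDet q z (S.erase x) -
      z * ∑ y ∈ S.erase x, G.transProb q x y * G.returnWeight q z (S.erase x) y (x :: l) x := by
  have h := Matrix.det_rowRestrict_erase ((z : ℂ) • G.M q) hx
  rw [popDet, popDet, popMatrix, popMatrix, h, Complex.sub_re, Complex.re_sum, Finset.mul_sum]
  congr 1
  rw [← Finset.sum_subset (Finset.subset_univ (S.erase x))]
  · refine Finset.sum_congr rfl fun y hy => ?_
    rw [returnWeight, arcPhase_cons_cons G (Finset.ne_of_mem_erase hy).symm, arcPhase_cons_self,
      Matrix.smul_apply, M_apply G hq, smul_eq_mul, one_mul, popMatrix, ← mul_assoc,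
      ← Complex.re_ofReal_mul, ← Complex.re_ofReal_mul]
    congr 1
    ring
  · intro y _ hy
    rw [Matrix.adjugate_rowRestrict_apply_of_notMem _ hy]
    split_ifs with hyx
    · subst hyx
      simp [M_apply G hq, transProb_self]
    · simp

/-- The real part of the holonomy of the cycle of the path that is closed by a step from its end `x`
to its vertex `v`. -/
noncomputable def closingCos (G : ConnectionGraph V) (x : V) (l : List V) (v : V) : ℝ :=
  (G.arcPhase (x :: l) v * G.phase x v).re

/-- The summand y = v is a step that closes a cycle at once. Its real part factors as a cosine times
a determinant because the determinant is real (`coe_popDet`). -/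
theorem returnWeight_erase (G : ConnectionGraph V) {q : ℝ} (hq : 0 < q) (z : ℝ) {S : Finset V}
    {x v : V} (hx : x ∈ S) (hv : v ∉ S) (l : List V) :
    G.returnWeight q z S x l v =
      z * (G.transProb q x v * (G.closingCos x l v * G.popDet q z (S.erase x)) +
        ∑ y ∈ S.erase x, G.transProb q x y * G.returnWeight q z (S.erase x) y (x :: l) v) := by
  have h := Matrix.adjugate_rowRestrict_erase ((z : ℂ) • G.M q) hx hv
  have hve : v ∉ S.erase x := fun h => hv (Finset.mem_of_mem_erase h)
  rw [returnWeight, popMatrix, h, Finset.mul_sum, Complex.re_sum,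
    ← Finset.sum_subset (Finset.subset_univ (insert v (S.erase x))), Finset.sum_insert hve,
    mul_add, Finset.mul_sum]
  · congr 1
    · rw [Matrix.adjugate_rowRestrict_apply_of_notMem _ hve, if_pos rfl, Matrix.smul_apply,
        M_apply G hq, smul_eq_mul, closingCos, ← popMatrix, ← coe_popDet G hq,
        ← Complex.re_mul_ofReal, ← Complex.re_ofReal_mul, ← Complex.re_ofReal_mul]
      congr 1
      ring
    · refine Finset.sum_congr rfl fun y hy => ?_
      rw [returnWeight, arcPhase_cons_cons G (show v ≠ y from fun e => hve (e ▸ hy)),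
        Matrix.smul_apply, M_apply G hq, smul_eq_mul, popMatrix,
        ← Complex.re_ofReal_mul, ← Complex.re_ofReal_mul]
      congr 1
      ring
  · intro y _ hy
    rw [Finset.mem_insert, not_or] at hy
    rw [Matrix.adjugate_rowRestrict_apply_of_notMem _ hy.2, if_neg hy.1]
    simp

/-- The generating function of the remaining running time when a new walk starts and the set of
unvisited vertices is `B`. -/
noncomputable def startValue (G : ConnectionGraph V) (q z : ℝ) (B : Finset V) : ℝ :=
  z ^ B.card * G.popDet q 1 B / G.popDet q z B

/-- The generating function of the remaining running time, if `B` is the set of the vertices that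
are not in the subgraph and if the current path is the part up to `v` of the path whose vertices
are listed in reversed order. -/
noncomputable def pathValue (G : ConnectionGraph V) (q z : ℝ) (B : Finset V) : List V → V → ℝ
  | [] => fun _ => 1
  | x :: l => Function.update (G.pathValue q z B l) x
      ((z ^ (B \ l.toFinset).card * (G.popDet q 1 (B \ l.toFinset) -
          ∑ v ∈ l.toFinset, G.returnWeight q 1 (B \ l.toFinset) x l v) +
        ∑ v ∈ l.toFinset, G.returnWeight q z (B \ l.toFinset) x l v * G.pathValue q z B l v) /
        G.popDet q z (B \ l.toFinset))

theorem pathValue_singleton (G : ConnectionGraph V) (q z : ℝ) (B : Finset V) (x : V) :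
    G.pathValue q z B [x] x = G.startValue q z B := by
  simp [pathValue, startValue]

/-- In the last sum the walk falls back to an earlier vertex v of the path by popping a cycle, and
the value at v takes over. The other term accounts for attachment before any such return: each
vertex of `B \ l.toFinset` then contributes one kept step, and the popped cycles contribute the
ratio of determinants. -/
theorem popDet_mul_pathValue (G : ConnectionGraph V) {q z : ℝ} {B : Finset V} {l : List V}
    (hz : G.popDet q z (B \ l.toFinset) ≠ 0) (x : V) :
    G.popDet q z (B \ l.toFinset) * G.pathValue q z B (x :: l) x =
      z ^ (B \ l.toFinset).card * (G.popDet q 1 (B \ l.toFinset) -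
          ∑ v ∈ l.toFinset, G.returnWeight q 1 (B \ l.toFinset) x l v) +
        ∑ v ∈ l.toFinset, G.returnWeight q z (B \ l.toFinset) x l v * G.pathValue q z B l v := by
  rw [pathValue, Function.update_self, mul_div_cancel₀ _ hz]

/-- The value at v depends only on the path up to v; hence it is also the value of the state reached
when a cycle is popped back to v. -/
theorem pathValue_append (G : ConnectionGraph V) (q z : ℝ) (B : Finset V) {k : List V} {v : V}
    (hv : v ∉ k) (l : List V) :
    G.pathValue q z B (k ++ v :: l) v = G.pathValue q z B (v :: l) v := by
  induction k with
  | nil => rfl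
  | cons x k ih =>
    rw [List.mem_cons, not_or] at hv
    rw [List.cons_append, pathValue, Function.update_of_ne hv.1, ih hv.2]

theorem pathValue_cons_of_ne (G : ConnectionGraph V) (q z : ℝ) (B : Finset V) {x v : V}
    (hv : v ≠ x) (l : List V) : G.pathValue q z B (x :: l) v = G.pathValue q z B l v := by
  rw [pathValue, Function.update_of_ne hv]

/-- The equation satisfied by the generating function of the remaining running time. -/
theorem pathValue_step (G : ConnectionGraph V) {q z : ℝ} (hq : 0 < q) {B : Finset V} {x : V}
    {l : List V} (hxB : x ∈ B) (hlB : l.toFinset ⊆ B) (hxl : x ∉ l)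
    (hz : ∀ S, G.popDet q z S ≠ 0) :
    G.pathValue q z B (x :: l) x =
      z * ((q / (G.deg x + q) + ∑ y ∈ Bᶜ, G.transProb q x y) *
          G.startValue q z (B \ (x :: l).toFinset) +
        ∑ v ∈ l.toFinset, G.transProb q x v *
          ((1 - G.closingCos x l v) * G.startValue q z (B \ (x :: l).toFinset) +
            G.closingCos x l v * G.pathValue q z B l v) +
        ∑ y ∈ B \ (x :: l).toFinset, G.transProb q x y *
          G.pathValue q z B (y :: x :: l) y) := by
  set S := B \ l.toFinset with hS
  set S' := B \ (x :: l).toFinset with hS'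
  have hxS : x ∈ S := by simp [hS, hxB, hxl]
  have hSe : S' = S.erase x := by
    ext y; simp only [hS, hS', Finset.mem_sdiff, List.toFinset_cons, Finset.mem_insert,
      Finset.mem_erase, not_or]; tauto
  have hcard : S.card = S'.card + 1 := by
    rw [hSe, Finset.card_erase_add_one hxS]
  have hdet : ∀ w, G.popDet q w S = G.popDet q w S' -
      w * ∑ y ∈ S', G.transProb q x y * G.returnWeight q w S' y (x :: l) x := fun w => by
    rw [hSe]; exact G.popDet_erase hq w hxS l
  have hret : ∀ w, ∀ v ∈ l.toFinset, G.returnWeight q w S x l v =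
      w * (G.transProb q x v * (G.closingCos x l v * G.popDet q w S') +
        ∑ y ∈ S', G.transProb q x y * G.returnWeight q w S' y (x :: l) v) := fun w v hv => by
    rw [hSe]
    exact G.returnWeight_erase hq w hxS (by simp [hS, List.mem_toFinset.1 hv]) l
  have hne : ∀ v ∈ l.toFinset, v ≠ x := fun v hv h => hxl (h ▸ List.mem_toFinset.1 hv)
  have hfin : (x :: l).toFinset = insert x l.toFinset := List.toFinset_cons
  have hxl' : x ∉ l.toFinset := by simpa using hxl
  set F := G.pathValue q z B (x :: l) x with hF
  set u : V → ℝ := fun v => G.pathValue q z B l v with hu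
  set A := q / (G.deg x + q) + ∑ y ∈ Bᶜ, G.transProb q x y with hA
  -- The transition probabilities from x sum to 1, and x itself contributes nothing because there
  -- are no loops.
  have hprob : A = 1 - ∑ v ∈ l.toFinset, G.transProb q x v - ∑ y ∈ S', G.transProb q x y := by
    have h1 := G.sum_transProb hq x
    have h2 := Finset.sum_compl_add_sum B (fun y => G.transProb q x y)
    have h3 := Finset.sum_sdiff (f := fun y => G.transProb q x y)
      (show (x :: l).toFinset ⊆ B by rw [hfin]; exact Finset.insert_subset hxB hlB)
    rw [hfin, Finset.sum_insert hxl', G.transProb_self, ← hfin, ← hS'] at h3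
    rw [hA]
    linarith
  have hnext : ∀ y, G.popDet q z S' * G.pathValue q z B (y :: x :: l) y =
      z ^ S'.card * (G.popDet q 1 S' - (G.returnWeight q 1 S' y (x :: l) x +
          ∑ v ∈ l.toFinset, G.returnWeight q 1 S' y (x :: l) v)) +
        (G.returnWeight q z S' y (x :: l) x * F +
        ∑ v ∈ l.toFinset, G.returnWeight q z S' y (x :: l) v * u v) := fun y => by
    have h := G.popDet_mul_pathValue (z := z) (B := B) (l := x :: l) (hz _) y
    rw [← hS', hfin, Finset.sum_insert hxl', Finset.sum_insert hxl'] at h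
    rw [h]
    congr 2
    exact Finset.sum_congr rfl fun v hv => by rw [G.pathValue_cons_of_ne q z B (hne v hv)]
  have hcur := G.popDet_mul_pathValue (z := z) (B := B) (l := l) (hz _) x
  rw [← hS, ← hF] at hcur
  have hstart : G.popDet q z S' * G.startValue q z S' = z ^ S'.card * G.popDet q 1 S' := by
    rw [startValue, mul_div_cancel₀ _ (hz _)]
  -- With the denominator cleared, every term is a combination of determinants and return weights on
  -- `S'`, where the recursions apply.
  apply mul_left_cancel₀ (hz S')
  have e1 : G.popDet q z S' * ∑ v ∈ l.toFinset, G.transProb q x v *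
          ((1 - G.closingCos x l v) * G.startValue q z S' + G.closingCos x l v * u v) =
      z ^ S'.card * G.popDet q 1 S' * ∑ v ∈ l.toFinset, G.transProb q x v -
      z ^ S'.card * G.popDet q 1 S' * ∑ v ∈ l.toFinset, G.transProb q x v * G.closingCos x l v +
      ∑ v ∈ l.toFinset, G.transProb q x v * (G.closingCos x l v * G.popDet q z S') * u v := by
    rw [Finset.mul_sum, Finset.mul_sum, Finset.mul_sum, ← Finset.sum_sub_distrib,
      ← Finset.sum_add_distrib]
    refine Finset.sum_congr rfl fun v _ => ?_
    linear_combination G.transProb q x v * (1 - G.closingCos x l v) * hstart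
  have e2 : G.popDet q z S' * ∑ y ∈ S', G.transProb q x y * G.pathValue q z B (y :: x :: l) y =
      z ^ S'.card * G.popDet q 1 S' * ∑ y ∈ S', G.transProb q x y -
      z ^ S'.card * ∑ y ∈ S', G.transProb q x y * G.returnWeight q 1 S' y (x :: l) x -
      z ^ S'.card * ∑ v ∈ l.toFinset, ∑ y ∈ S',
        G.transProb q x y * G.returnWeight q 1 S' y (x :: l) v +
      (∑ y ∈ S', G.transProb q x y * G.returnWeight q z S' y (x :: l) x) * F +
      ∑ v ∈ l.toFinset, (∑ y ∈ S',
        G.transProb q x y * G.returnWeight q z S' y (x :: l) v) * u v := by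
    simp only [Finset.sum_mul]
    rw [Finset.sum_comm (s := l.toFinset), Finset.sum_comm (s := l.toFinset)]
    simp only [Finset.mul_sum]
    rw [← Finset.sum_sub_distrib, ← Finset.sum_sub_distrib, ← Finset.sum_add_distrib,
      ← Finset.sum_add_distrib]
    refine Finset.sum_congr rfl fun y _ => ?_
    have := hnext y
    have s1 : ∑ v ∈ l.toFinset, z ^ S'.card * (G.transProb q x y *
        G.returnWeight q 1 S' y (x :: l) v) = z ^ S'.card * (G.transProb q x y *
        ∑ v ∈ l.toFinset, G.returnWeight q 1 S' y (x :: l) v) := by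
      simp only [Finset.mul_sum]
    have s2 : ∑ v ∈ l.toFinset, G.transProb q x y * G.returnWeight q z S' y (x :: l) v * u v =
        G.transProb q x y * ∑ v ∈ l.toFinset, G.returnWeight q z S' y (x :: l) v * u v := by
      simp only [Finset.mul_sum, mul_assoc]
    rw [s1, s2]
    linear_combination G.transProb q x y * this
  have e3 : ∑ v ∈ l.toFinset, G.returnWeight q z S x l v * u v =
      z * (∑ v ∈ l.toFinset, G.transProb q x v * (G.closingCos x l v * G.popDet q z S') * u v +
        ∑ v ∈ l.toFinset, (∑ y ∈ S',
        G.transProb q x y * G.returnWeight q z S' y (x :: l) v) * u v) := by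
    rw [← Finset.sum_add_distrib, Finset.mul_sum]
    refine Finset.sum_congr rfl fun v hv => ?_
    rw [hret z v hv]
    ring
  have e4 : ∑ v ∈ l.toFinset, G.returnWeight q 1 S x l v =
      G.popDet q 1 S' * ∑ v ∈ l.toFinset, G.transProb q x v * G.closingCos x l v +
        ∑ v ∈ l.toFinset, ∑ y ∈ S',
        G.transProb q x y * G.returnWeight q 1 S' y (x :: l) v := by
    rw [Finset.mul_sum, ← Finset.sum_add_distrib]
    refine Finset.sum_congr rfl fun v hv => ?_
    rw [hret 1 v hv]
    ring
  have hz1 := hdet z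
  have h11 := hdet 1
  rw [e3, e4, hcard, pow_succ] at hcur
  rw [show G.popDet q z S' * (z * (A * G.startValue q z S' + ∑ v ∈ l.toFinset, G.transProb q x v *
          ((1 - G.closingCos x l v) * G.startValue q z S' + G.closingCos x l v * u v) +
          ∑ y ∈ S', G.transProb q x y * G.pathValue q z B (y :: x :: l) y)) =
      z * (A * (G.popDet q z S' * G.startValue q z S') +
        G.popDet q z S' * ∑ v ∈ l.toFinset, G.transProb q x v *
          ((1 - G.closingCos x l v) * G.startValue q z S' + G.closingCos x l v * u v) +
        G.popDet q z S' * ∑ y ∈ S', G.transProb q x y * G.pathValue q z B (y :: x :: l) y)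
      by ring, hstart, e1, e2, hprob]
  -- Walks returning to x bring back the unknown F itself; `hz1` absorbs them into the determinant
  -- on S, and `h11` does the same at z = 1.
  linear_combination hcur - F * hz1 + z ^ S'.card * z * h11

/-- At `z = 1` the generating function is `1`. -/
theorem pathValue_one (G : ConnectionGraph V) {q : ℝ} (hq : 0 < q) (B : Finset V) (l : List V)
    (v : V) : G.pathValue q 1 B l v = 1 := by
  induction l generalizing v with
  | nil => rfl
  | cons x l ih =>
    by_cases hv : v = x
    · subst hv
      apply mul_left_cancel₀ (G.popDet_one_ne_zero hq (B \ l.toFinset))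
      rw [popDet_mul_pathValue G (G.popDet_one_ne_zero hq _)]
      simp [ih]
    · rw [pathValue_cons_of_ne G q 1 B hv, ih]

theorem continuousAt_pathValue (G : ConnectionGraph V) {q : ℝ} (hq : 0 < q) (B : Finset V)
    (l : List V) (v : V) : ContinuousAt (fun z => G.pathValue q z B l v) 1 := by
  induction l generalizing v with
  | nil => exact continuousAt_const
  | cons x l ih =>
    by_cases hv : v = x
    · subst hv
      simp only [pathValue, Function.update_self]
      have hr : ∀ u, Continuous fun z => G.returnWeight q z (B \ l.toFinset) v l u := fun u =>
        Complex.continuous_re.comp (continuous_const.mul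
          ((G.continuous_popMatrix q _).matrix_adjugate.matrix_elem v u))
      refine ContinuousAt.div ?_ (G.continuous_popDet q _).continuousAt
        (G.popDet_one_ne_zero hq _)
      refine ContinuousAt.add (by fun_prop) ?_
      exact tendsto_finsetSum _ fun u _ => ((hr u).continuousAt.mul (ih u))
    · simp only [pathValue_cons_of_ne G q _ B hv]
      exact ih v

end ConnectionGraph

/-! ### Finite expectations and list lemmas. -/

namespace PMF

/-- The expectation of `f` restricted to the finite set `A`. -/
noncomputable def sumOn {S : Type*} (A : Finset S) (p : PMF S) (f : S → ℝ) : ℝ :=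
  ∑ t ∈ A, (p t).toReal * f t

theorem sumOn_pure {S : Type*} {A : Finset S} {a : S} (ha : a ∈ A) (f : S → ℝ) :
    (PMF.pure a).sumOn A f = f a := by
  classical
  rw [sumOn, Finset.sum_eq_single a]
  · simp
  · intro t _ ht
    simp [PMF.pure_apply, ht]
  · exact fun h => (h ha).elim

theorem sumOn_bind {S Y : Type*} [Fintype Y] (A : Finset S) (p : PMF Y) (g : Y → PMF S)
    (f : S → ℝ) : (p.bind g).sumOn A f = ∑ y, (p y).toReal * (g y).sumOn A f := by
  simp only [sumOn, Finset.mul_sum]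
  rw [Finset.sum_comm]
  refine Finset.sum_congr rfl fun t _ => ?_
  rw [PMF.bind_apply, tsum_fintype, ENNReal.toReal_sum
    fun y _ => ENNReal.mul_ne_top (p.apply_ne_top y) ((g y).apply_ne_top t), Finset.sum_mul]
  exact Finset.sum_congr rfl fun y _ => by rw [ENNReal.toReal_mul, mul_assoc]

end PMF

namespace List

theorem takeWhile_ne_append {V : Type*} [DecidableEq V] {v : V} {a : List V} (hv : v ∉ a)
    (b : List V) : (a ++ v :: b).takeWhile (fun z => decide (z ≠ v)) = a := by
  induction a with
  | nil => simp
  | cons x a ih =>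
    rw [mem_cons, not_or] at hv
    rw [cons_append, takeWhile_cons_of_pos (by simpa using Ne.symm hv.1), ih hv.2]

theorem dropWhile_ne_append {V : Type*} [DecidableEq V] {v : V} {a : List V} (hv : v ∉ a)
    (b : List V) : (a ++ v :: b).dropWhile (fun z => decide (z ≠ v)) = v :: b := by
  induction a with
  | nil => simp
  | cons x a ih =>
    rw [mem_cons, not_or] at hv
    rw [cons_append, dropWhile_cons_of_pos (by simpa using Ne.symm hv.1), ih hv.2]

theorem IsChain.rel_of_mem_zip {V : Type*} {R : V → V → Prop} {v w : V} {b : List V}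
    (h : (v :: (b ++ [w])).IsChain R) : ∀ e ∈ (v :: b).zip (b ++ [w]), R e.1 e.2 := by
  induction b generalizing v with
  | nil =>
    intro e he
    simp only [nil_append, zip_cons_cons, zip_nil_right, mem_singleton] at he
    subst he
    simpa using h
  | cons y b ih =>
    intro e he
    rw [cons_append, isChain_cons_cons] at h
    rw [cons_append, zip_cons_cons, mem_cons] at he
    rcases he with rfl | he
    · exact h.1
    · exact ih h.2 e he

end List

/-! ### Invariants of the algorithm and the one-step equation for its states. -/

namespace ConnectionGraph

section

variable {V : Type*}

theorem holonomy_cons (G : ConnectionGraph V) (v : V) (b : List V) :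
    G.holonomy (v :: b) =
      (((v :: b).zip (b ++ [v])).map fun e => G.phase e.1 e.2).prod := by
  simp [holonomy]

theorem isOrientedCycle_cons (G : ConnectionGraph V) {v x : V} {b : List V}
    (hn : (v :: (b ++ [x])).Nodup) (hc : (v :: (b ++ [x])).IsChain G.graph.Adj)
    (hx : G.graph.Adj x v) : G.IsOrientedCycle (v :: (b ++ [x])) := by
  refine ⟨by simp, hn, ?_⟩
  have h2 : (v :: ((b ++ [x]) ++ [v])).IsChain G.graph.Adj := by
    rw [← List.cons_append, List.isChain_append]
    refine ⟨hc, by simp, ?_⟩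
    intro y hy z hz
    rw [← List.cons_append, List.getLast?_append] at hy
    simp at hy hz
    subst hy hz
    exact hx
  simpa using h2.rel_of_mem_zip

end

variable {V : Type*} [DecidableEq V]

/-- Here `r` is the reversed part of the path after v. For w = v the right-hand side is the holonomy
of the cycle being closed. -/
theorem arcPhase_mul_phase [Fintype V] (G : ConnectionGraph V) {v : V} (k : List V) {r : List V}
    (hv : v ∉ r) {x : V} {l : List V} (hr : r ++ v :: k = x :: l) (w : V) :
    G.arcPhase (x :: l) v * G.phase x w =
      (((v :: r.reverse).zip (r.reverse ++ [w])).map fun e => G.phase e.1 e.2).prod := by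
  induction r generalizing x l w with
  | nil =>
    rw [List.nil_append, List.cons.injEq] at hr
    obtain ⟨rfl, rfl⟩ := hr
    simp [arcPhase_cons_self]
  | cons y r ih =>
    rw [List.cons_append, List.cons.injEq] at hr
    obtain ⟨rfl, hl⟩ := hr
    rw [List.mem_cons, not_or] at hv
    obtain ⟨x', l', rfl⟩ : ∃ x' l', l = x' :: l' := by
      cases l with
      | nil => simp at hl
      | cons x' l' => exact ⟨x', l', rfl⟩
    rw [arcPhase_cons_cons G hv.1, ih hv.2 hl, List.reverse_cons, ← List.cons_append,
      List.zip_append (by simp), List.map_append, List.prod_append]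
    simp

/-- The vertices that are not in a subgraph. -/
def unvisited [Fintype V] (nodes : Finset (Option V)) : Finset V :=
  Finset.univ.filter fun x => some x ∉ nodes

@[simp] theorem mem_unvisited [Fintype V] {nodes : Finset (Option V)} {x : V} :
    x ∈ unvisited nodes ↔ some x ∉ nodes := by simp [unvisited]

namespace State

/-- The invariants of the algorithm. -/
structure IsGood (G : ConnectionGraph V) (s : State V) : Prop where
  root_mem : none ∈ s.nodes
  nodup : s.path.Nodup
  disjoint : ∀ x ∈ s.path, some x ∉ s.nodes
  isChain : s.path.IsChain G.graph.Adj
  isDone : s.path = [] → s.IsDone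

theorem IsGood.path_eq_nil {G : ConnectionGraph V} {s : State V} (h : s.IsGood G)
    (hd : s.IsDone) : s.path = [] :=
  List.eq_nil_iff_forall_not_mem.2 fun x hx => h.disjoint x hx (hd _)

/-- Paths without repetition are finite in number, although `State V` allows arbitrary lists. This
reduces the chain to a finite state space. -/
theorem finite_setOf_isGood [Fintype V] (G : ConnectionGraph V) :
    {s : State V | s.IsGood G}.Finite := by
  let f : Finset (Option V) × Finset (V × Option V) × {l : List V // l.Nodup} → State V :=
    fun p => ⟨p.1, p.2.1, p.2.2⟩
  exact (Set.finite_range f).subset fun s hs => ⟨(s.nodes, s.edges, ⟨s.path, hs.nodup⟩), rfl⟩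

instance [Fintype V] : Countable (State V) := by
  have : Function.Injective fun s : State V => (s.nodes, s.edges, s.path) := by
    rintro ⟨a, b, c⟩ ⟨a', b', c'⟩ h
    simpa using h
  exact this.countable

end State

variable [Fintype V]

theorem start_cases (ι : Fin (Fintype.card V) ≃ V) (nodes : Finset (Option V))
    (edges : Finset (V × Option V)) :
    ((start ι nodes edges).path = [] ∧ unvisited nodes = ∅) ∨
      ∃ x ∈ unvisited nodes, (start ι nodes edges).path = [x] := by
  rcases h : ((List.finRange (Fintype.card V)).map ι).find? fun x => decide (some x ∉ nodes) with
    _ | x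
  · left
    refine ⟨by simp only [start, h, Option.toList_none], ?_⟩
    rw [List.find?_eq_none] at h
    ext x
    have := h x (by simpa using ⟨ι.symm x, by simp⟩)
    simpa using this
  · right
    have := List.find?_some h
    exact ⟨x, by simpa using this, by simp only [start, h, Option.toList_some]⟩

theorem isGood_start (G : ConnectionGraph V) (ι : Fin (Fintype.card V) ≃ V)
    {nodes : Finset (Option V)} (hr : none ∈ nodes) (edges : Finset (V × Option V)) :
    (start ι nodes edges).IsGood G := by
  rcases start_cases ι nodes edges with ⟨h, hu⟩ | ⟨x, hx, h⟩
  · refine ⟨hr, by simp [h], by simp [h], by simp [h], fun _ y => ?_⟩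
    cases y with
    | none => exact hr
    | some y =>
      by_contra hy
      have : y ∈ unvisited nodes := mem_unvisited.2 hy
      simp [hu] at this
  · exact ⟨hr, by simp [h], by
      intro y hy
      rw [h, List.mem_singleton] at hy
      exact hy ▸ mem_unvisited.1 hx, by simp [h], by simp [h]⟩

theorem isGood_attach (G : ConnectionGraph V) (ι : Fin (Fintype.card V) ≃ V) {s : State V}
    (hs : s.IsGood G) (y : Option V) : (attach ι s y).IsGood G :=
  isGood_start G ι (Finset.mem_union_left _ hs.root_mem) _

theorem isGood_extend {G : ConnectionGraph V} {s : State V} (hs : s.IsGood G) {x v : V}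
    (hx : s.path.getLast? = some x) (hv : v ∉ s.path) (hvn : some v ∉ s.nodes)
    (hxv : G.graph.Adj x v) : ({ s with path := s.path ++ [v] } : State V).IsGood G := by
  refine ⟨hs.root_mem, ?_, ?_, ?_, by simp⟩
  · rw [List.nodup_append]
    exact ⟨hs.nodup, by simp, fun a ha b hb => by
      rw [List.mem_singleton] at hb; rintro rfl; exact hv (hb ▸ ha)⟩
  · intro y hy
    rcases List.mem_append.1 hy with hy | hy
    · exact hs.disjoint y hy
    · rw [List.mem_singleton] at hy
      exact hy ▸ hvn
  · rw [List.isChain_append]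
    refine ⟨hs.isChain, by simp, ?_⟩
    intro a ha b hb
    rw [hx] at ha
    simp at ha hb
    subst ha hb
    exact hxv

theorem isGood_pop {G : ConnectionGraph V} {s : State V} (hs : s.IsGood G) {v : V}
    (hv : v ∈ s.path) :
    ({ s with path := (s.path.takeWhile fun z => decide (z ≠ v)) ++ [v] } : State V).IsGood G := by
  obtain ⟨a, b, hab⟩ := List.append_of_mem hv
  have hva : v ∉ a := by
    have := hs.nodup
    rw [hab, List.nodup_append] at this
    exact fun h => this.2.2 v h v (by simp) rfl
  have hp : a ++ [v] <+: s.path := ⟨b, by simp [hab]⟩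
  rw [hab, List.takeWhile_ne_append hva]
  exact ⟨hs.root_mem, hs.nodup.sublist hp.sublist, fun x hx => hs.disjoint x (hp.subset hx),
    hs.isChain.prefix hp, by simp⟩

theorem toReal_srw_some (G : ConnectionGraph V) {q : ℝ} (hq : 0 < q) (x y : V) :
    (G.srw q hq x (some y)).toReal = G.transProb q x y := by
  rw [srw, PMF.ofFintype_apply]
  exact ENNReal.toReal_ofReal (G.transProb_nonneg hq x y)

theorem toReal_srw_none (G : ConnectionGraph V) {q : ℝ} (hq : 0 < q) (x : V) :
    (G.srw q hq x none).toReal = q / (G.deg x + q) := by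
  rw [srw, PMF.ofFintype_apply, ENNReal.toReal_ofReal]
  · rfl
  · exact div_nonneg hq.le (G.deg_add_pos hq x).le

theorem adj_of_transProb_ne_zero {G : ConnectionGraph V} {q : ℝ} {x y : V}
    (h : G.transProb q x y ≠ 0) : G.graph.Adj x y := by
  by_contra hxy
  exact h (by rw [transProb, G.weight_eq_zero x y hxy, zero_div])

theorem adj_of_srw_ne_zero {G : ConnectionGraph V} {q : ℝ} {hq : 0 < q} {x y : V}
    (h : G.srw q hq x (some y) ≠ 0) : G.graph.Adj x y := by
  refine adj_of_transProb_ne_zero (q := q) ?_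
  rw [← G.toReal_srw_some hq]
  exact ENNReal.toReal_ne_zero.2 ⟨h, PMF.apply_ne_top _ _⟩

theorem step_of_path_eq_nil (G : ConnectionGraph V) {q : ℝ} (hq : 0 < q)
    (ι : Fin (Fintype.card V) ≃ V) {s : State V} (h : s.path = []) :
    G.step q hq ι s = PMF.pure s := by
  simp [step, h]

theorem isGood_of_step_ne_zero (G : ConnectionGraph V) {q : ℝ} (hq : 0 < q)
    (ι : Fin (Fintype.card V) ≃ V) {s t : State V} (hs : s.IsGood G)
    (h : G.step q hq ι s t ≠ 0) : t.IsGood G := by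
  have hpure : ∀ {a : State V}, a.IsGood G → t ∈ (PMF.pure a).support → t.IsGood G := by
    intro a ha ht
    rw [PMF.support_pure, Set.mem_singleton_iff] at ht
    exact ht ▸ ha
  rw [← PMF.mem_support_iff] at h
  rcases hx : s.path.getLast? with _ | x
  · rw [step, hx] at h
    exact hpure hs h
  · rw [step, hx] at h
    simp only [PMF.mem_support_bind_iff] at h
    obtain ⟨y, hy, h⟩ := h
    split_ifs at h with hyn
    · exact hpure (isGood_attach G ι hs _) h
    · cases y with
      | none => exact (hyn hs.root_mem).elim
      | some v =>
        simp only at h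
        split_ifs at h with hv
        · rw [PMF.mem_support_bind_iff] at h
          obtain ⟨b, -, h⟩ := h
          split_ifs at h
          · exact hpure (isGood_attach G ι hs _) h
          · exact hpure (isGood_pop hs hv) h
        · exact hpure (isGood_extend hs hx hv hyn
            (adj_of_srw_ne_zero ((PMF.mem_support_iff _ _).1 hy))) h

/-- The generating function of the remaining running time. -/
noncomputable def stateValue (G : ConnectionGraph V) (q z : ℝ) (s : State V) : ℝ :=
  G.pathValue q z (unvisited s.nodes) s.path.reverse (s.path.getLast?.getD
    (Classical.choice G.connected.nonempty))

/-- The arbitrary default vertex in `stateValue` is harmless, as `pathValue` is constantly 1 on the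
empty path. -/
theorem stateValue_of_path_eq_nil (G : ConnectionGraph V) (q z : ℝ) {s : State V}
    (h : s.path = []) : G.stateValue q z s = 1 := by
  simp [stateValue, h, pathValue]

theorem stateValue_eq (G : ConnectionGraph V) (q z : ℝ) {s : State V} {x : V} {l : List V}
    (h : s.path = l.reverse ++ [x]) :
    G.stateValue q z s = G.pathValue q z (unvisited s.nodes) (x :: l) x := by
  simp [stateValue, h]

theorem stateValue_start (G : ConnectionGraph V) (q z : ℝ) (ι : Fin (Fintype.card V) ≃ V)
    (nodes : Finset (Option V)) (edges : Finset (V × Option V)) :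
    G.stateValue q z (start ι nodes edges) = G.startValue q z (unvisited nodes) := by
  rcases start_cases ι nodes edges with ⟨h, hu⟩ | ⟨x, -, h⟩
  · rw [stateValue_of_path_eq_nil G q z h, hu, startValue]
    simp [popDet_empty]
  · rw [stateValue_eq G q z (x := x) (l := []) (by simp [h]), pathValue_singleton]
    rfl

theorem stateValue_attach (G : ConnectionGraph V) (q z : ℝ) (ι : Fin (Fintype.card V) ≃ V)
    (s : State V) (y : Option V) :
    G.stateValue q z (attach ι s y) =
      G.startValue q z (unvisited s.nodes \ s.path.toFinset) := by
  rw [attach, stateValue_start]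
  congr 1
  ext v
  simp [not_or]

theorem toReal_coin_true (p : unitInterval) : (coin p true).toReal = p := by
  rw [coin, PMF.ofFintype_apply, if_pos rfl, ENNReal.toReal_ofReal p.2.1]

theorem toReal_coin_false (p : unitInterval) : (coin p false).toReal = 1 - p := by
  rw [coin, PMF.ofFintype_apply, if_neg (by simp), ENNReal.toReal_ofReal (sub_nonneg.2 p.2.2)]

/-- The probability of accepting the cycle that is closed by a step from the end `x` of the path to
its vertex `v`. -/
theorem acceptProb_dropWhile (G : ConnectionGraph V) (hweak : G.WeaklyInconsistent) {s : State V}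
    (hs : s.IsGood G) {x v : V} {l : List V} (hp : s.path = l.reverse ++ [x]) (hv : v ∈ l)
    (hxv : G.graph.Adj x v) :
    (G.acceptProb (s.path.dropWhile fun z => decide (z ≠ v)) : ℝ) = 1 - G.closingCos x l v := by
  obtain ⟨a, b, hab⟩ := List.append_of_mem hv
  have hpath : s.path = b.reverse ++ v :: (a.reverse ++ [x]) := by simp [hp, hab]
  have hn := hs.nodup
  have hc := hs.isChain
  rw [hpath] at hn hc
  have hvb : v ∉ b.reverse := by
    rw [List.nodup_append] at hn
    exact fun h => hn.2.2 v h v (by simp) rfl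
  have hn' : (v :: (a.reverse ++ [x])).Nodup := (List.nodup_append.1 hn).2.1
  have hc' : (v :: (a.reverse ++ [x])).IsChain G.graph.Adj := (List.isChain_append.1 hc).2.1
  rw [hpath, List.dropWhile_ne_append hvb, coe_acceptProb _ _
    (hweak _ (isOrientedCycle_cons G hn' hc' hxv)), cosTheta, closingCos]
  have hvx : v ∉ x :: a := by
    have := (List.nodup_cons.1 hn').1
    simpa [or_comm] using this
  rw [G.arcPhase_mul_phase b hvx (x := x) (l := l) (by simp [hab]) v, holonomy_cons,
    List.reverse_cons]

/-- The step is split by its target: the root or a visited vertex (attachment), a new vertex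
(extension), or a vertex of the path (a cycle, accepted or popped). These are the terms of
`pathValue_step`. -/
theorem stateValue_step (G : ConnectionGraph V) (hweak : G.WeaklyInconsistent) {q z : ℝ}
    (hq : 0 < q) (ι : Fin (Fintype.card V) ≃ V) (hz : ∀ S, G.popDet q z S ≠ 0)
    {A : Finset (State V)} (hA : ∀ s, s ∈ A ↔ s.IsGood G) {s : State V} (hs : s.IsGood G)
    (hd : ¬ s.IsDone) :
    G.stateValue q z s = z * (G.step q hq ι s).sumOn A (G.stateValue q z) := by
  obtain ⟨x, l, hp⟩ : ∃ (x : V) (l : List V), s.path = l.reverse ++ [x] := by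
    rcases List.eq_nil_or_concat s.path with h | ⟨l, x, h⟩
    · exact (hd (hs.isDone h)).elim
    · exact ⟨x, l.reverse, by simpa using h⟩
  have hlast : s.path.getLast? = some x := by simp [hp]
  have hmem : ∀ v, v ∈ s.path ↔ v ∈ x :: l := fun v => by simp [hp, or_comm]
  have hfin : s.path.toFinset = (x :: l).toFinset := by
    ext v; rw [List.mem_toFinset, List.mem_toFinset, hmem]
  set B := unvisited s.nodes with hB
  have hxB : x ∈ B := by rw [hB, mem_unvisited]; exact hs.disjoint x ((hmem x).2 (by simp))
  have hlB : l.toFinset ⊆ B := fun v hv => by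
    rw [hB, mem_unvisited]
    exact hs.disjoint v ((hmem v).2 (List.mem_cons_of_mem _ (List.mem_toFinset.1 hv)))
  have hxl : x ∉ l := by
    have := hs.nodup
    rw [hp, List.nodup_append] at this
    exact fun h => this.2.2 x (by simpa using h) x (by simp) rfl
  have hatt : ∀ y, (PMF.pure (attach ι s y)).sumOn A (G.stateValue q z) =
      G.startValue q z (B \ (x :: l).toFinset) := fun y => by
    rw [PMF.sumOn_pure ((hA _).2 (isGood_attach G ι hs y)), stateValue_attach, hfin]
  rw [stateValue_eq G q z hp, G.pathValue_step hq hxB hlB hxl hz]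
  congr 1
  rw [step, hlast]
  simp only
  rw [PMF.sumOn_bind, Fintype.sum_option, toReal_srw_none, if_pos hs.root_mem, hatt, add_mul,
    add_assoc, add_assoc]
  congr 1
  rw [← Finset.sum_compl_add_sum B, ← Finset.sum_sdiff
    (show (x :: l).toFinset ⊆ B by
      rw [List.toFinset_cons]; exact Finset.insert_subset hxB hlB)]
  congr 1
  · rw [Finset.sum_mul]
    refine Finset.sum_congr rfl fun y hy => ?_
    rw [Finset.mem_compl, hB, mem_unvisited, not_not] at hy
    rw [if_pos hy, hatt, toReal_srw_some]
  rw [add_comm]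
  congr 1
  · refine Finset.sum_congr rfl fun y hy => ?_
    rw [Finset.mem_sdiff, hB, mem_unvisited, List.mem_toFinset, ← hmem] at hy
    rw [toReal_srw_some, if_neg hy.1]
    simp only
    rw [if_neg hy.2]
    -- The extended path satisfies the invariants only along an edge; a non-edge has probability 0.
    by_cases h0 : G.transProb q x y = 0
    · rw [h0, zero_mul, zero_mul]
    · congr 1
      rw [PMF.sumOn_pure ((hA _).2 (isGood_extend hs hlast hy.2 hy.1
        (adj_of_transProb_ne_zero h0))), stateValue_eq G q z (x := y) (l := x :: l)
        (by simp [hp])]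
  · rw [List.toFinset_cons, Finset.sum_insert (by simpa using hxl), toReal_srw_some,
      transProb_self, zero_mul, zero_add]
    refine Finset.sum_congr rfl fun v hv => ?_
    have hvB := hlB hv
    rw [hB, mem_unvisited] at hvB
    rw [List.mem_toFinset] at hv
    have hvp : v ∈ s.path := (hmem v).2 (List.mem_cons_of_mem _ hv)
    rw [toReal_srw_some, if_neg hvB]
    simp only
    rw [if_pos hvp]
    by_cases h0 : G.transProb q x v = 0
    · rw [h0, zero_mul, zero_mul]
    · congr 1
      rw [PMF.sumOn_bind, Fintype.sum_bool, toReal_coin_true, toReal_coin_false,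
        acceptProb_dropWhile G hweak hs hp hv (adj_of_transProb_ne_zero h0), if_pos rfl,
        if_neg (by simp), hatt, List.toFinset_cons,
        PMF.sumOn_pure ((hA _).2 (isGood_pop hs hvp)), sub_sub_cancel]
      congr 2
      obtain ⟨a, b, hab⟩ := List.append_of_mem hv
      have hpath : s.path = b.reverse ++ v :: (a.reverse ++ [x]) := by simp [hp, hab]
      have hn := hs.nodup
      rw [hpath, List.nodup_append] at hn
      have hvb : v ∉ b.reverse := fun h => hn.2.2 v h v (by simp) rfl
      have hva : v ∉ a := fun h => (List.nodup_cons.1 hn.2.1).1 (by simp [h])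
      rw [stateValue_eq G q z (x := v) (l := b)
        (by rw [hpath, List.takeWhile_ne_append hvb]), hab,
        pathValue_append G q z _ hva]

end ConnectionGraph

/-! ### Markov chains and the generating function of an absorption time. -/

open MeasureTheory Filter Topology

namespace ConnectionGraph.IsMarkovChain

variable {Ω S : Type*} [MeasurableSpace Ω] [DecidableEq S] [Countable S]
  {P : Measure Ω} [IsProbabilityMeasure P] {κ : S → PMF S} {s₀ : S} {X : ℕ → Ω → S}

theorem measurableSet_mem (h : IsMarkovChain P κ s₀ X) (n : ℕ) (A : Set S) :
    MeasurableSet {ω | X n ω ∈ A} := by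
  have : {ω | X n ω ∈ A} = ⋃ s ∈ A, {ω | X n ω = s} := by ext; simp
  rw [this]
  exact MeasurableSet.biUnion A.to_countable fun s _ => h.measurableSet_eq n s

/-- Path probabilities are summed over the countably many trajectories up to time n that end at s;
each acquires the factor `κ s t`. -/
theorem measure_inter_eq (h : IsMarkovChain P κ s₀ X) (n : ℕ) (s t : S) :
    P ({ω | X n ω = s} ∩ {ω | X (n + 1) ω = t}) = P {ω | X n ω = s} * κ s t := by
  let Y : Ω → (Fin (n + 1) → S) := fun ω k => X k ω
  let ext : (Fin (n + 1) → S) → ℕ → S := fun p k => if hk : k < n + 1 then p ⟨k, hk⟩ else t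
  have hY : ∀ p, Y ⁻¹' {p} = {ω | ∀ k ≤ n, X k ω = ext p k} := by
    intro p
    ext1 ω
    simp only [Set.mem_preimage, Set.mem_singleton_iff, Set.mem_ofPred_eq, funext_iff, Y, ext]
    constructor
    · intro H k hk
      rw [dif_pos (Nat.lt_succ_of_le hk)]
      exact H ⟨k, Nat.lt_succ_of_le hk⟩
    · intro H k
      have := H k (Nat.lt_succ_iff.1 k.2)
      rwa [dif_pos k.2] at this
  have hYt : ∀ p, Y ⁻¹' {p} ∩ {ω | X (n + 1) ω = t} =
      {ω | ∀ k ≤ n + 1, X k ω = ext p k} := by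
    intro p
    rw [hY]
    ext1 ω
    simp only [Set.mem_inter_iff, Set.mem_ofPred_eq]
    constructor
    · rintro ⟨H1, H2⟩ k hk
      rcases Nat.lt_or_ge k (n + 1) with hk' | hk'
      · exact H1 k (Nat.lt_succ_iff.1 hk')
      · have : k = n + 1 := le_antisymm hk hk'
        subst this
        simp [ext, H2]
    · intro H
      exact ⟨fun k hk => H k (hk.trans n.le_succ), by simpa [ext] using H (n + 1) le_rfl⟩
  have hYm : ∀ p, MeasurableSet (Y ⁻¹' {p}) := by
    intro p
    have : Y ⁻¹' {p} = ⋂ k : Fin (n + 1), {ω | X k ω = p k} := by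
      ext1 ω; simp [Y, funext_iff]
    rw [this]
    exact MeasurableSet.iInter fun k => h.measurableSet_eq k (p k)
  let A : Set (Fin (n + 1) → S) := {p | p (Fin.last n) = s}
  have hA : Y ⁻¹' A = {ω | X n ω = s} := by ext1 ω; simp [Y, A]
  have hprod : ∀ p ∈ A, P (Y ⁻¹' {p} ∩ {ω | X (n + 1) ω = t}) = P (Y ⁻¹' {p}) * κ s t := by
    intro p hp
    rw [hYt, hY, h.prob_path, h.prob_path, Finset.prod_range_succ, mul_assoc]
    congr 2
    have h1 : ext p n = s := by
      have : p (Fin.last n) = s := hp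
      rw [← this]
      simp only [ext, dif_pos (Nat.lt_succ_self n)]
      rfl
    have h2 : ext p (n + 1) = t := by simp [ext]
    rw [h1, h2]
  have e1 := tsum_measure_preimage_singleton (μ := P) A.to_countable (f := Y) fun p _ => hYm p
  have e2 := tsum_measure_preimage_singleton (μ := P.restrict {ω | X (n + 1) ω = t})
    A.to_countable (f := Y) fun p _ => hYm p
  rw [Measure.restrict_apply' (h.measurableSet_eq _ _), hA] at e2
  rw [hA] at e1
  rw [← e2, ← e1, ← ENNReal.tsum_mul_right]
  refine tsum_congr fun p => ?_
  rw [Measure.restrict_apply' (h.measurableSet_eq _ _), hprod p p.2]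

theorem ae_zero_eq (h : IsMarkovChain P κ s₀ X) : ∀ᵐ ω ∂P, X 0 ω = s₀ := by
  have := h.prob_path 0 fun _ => s₀
  simp only [nonpos_iff_eq_zero, forall_eq, if_true, Finset.range_zero, Finset.prod_empty,
    mul_one] at this
  exact (prob_compl_eq_zero_iff (h.measurableSet_eq 0 s₀)).2 this

theorem ae_transition_ne_zero (h : IsMarkovChain P κ s₀ X) :
    ∀ᵐ ω ∂P, ∀ n, κ (X n ω) (X (n + 1) ω) ≠ 0 := by
  rw [ae_all_iff]
  intro n
  have : ∀ᵐ ω ∂P, ∀ s t, κ s t = 0 → ¬ (X n ω = s ∧ X (n + 1) ω = t) := by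
    simp only [ae_all_iff]
    intro s t hst
    have := h.measure_inter_eq n s t
    rw [hst, mul_zero] at this
    rw [ae_iff]
    simpa [Set.inter_def] using this
  filter_upwards [this] with ω hω h0
  exact hω _ _ h0 ⟨rfl, rfl⟩

theorem ae_mem (h : IsMarkovChain P κ s₀ X) {A : Set S} (h0 : s₀ ∈ A)
    (hA : ∀ s ∈ A, ∀ t, κ s t ≠ 0 → t ∈ A) : ∀ᵐ ω ∂P, ∀ n, X n ω ∈ A := by
  filter_upwards [h.ae_zero_eq, h.ae_transition_ne_zero] with ω h1 h2 n
  induction n with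
  | zero => rwa [h1]
  | succ n ih => exact hA _ ih _ (h2 n)

theorem integrable_integral_eq_sum (h : IsMarkovChain P κ s₀ X) {A : Finset S}
    (hA : ∀ᵐ ω ∂P, ∀ n, X n ω ∈ A) (n : ℕ) (f : S → ℝ) :
    Integrable (fun ω => f (X n ω)) P ∧
      ∫ ω, f (X n ω) ∂P = ∑ s ∈ A, P.real {ω | X n ω = s} * f s := by
  have hae : (fun ω => f (X n ω)) =ᵐ[P]
      fun ω => ∑ s ∈ A, {ω | X n ω = s}.indicator (fun _ => f s) ω := by
    filter_upwards [hA] with ω hω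
    rw [Finset.sum_eq_single (X n ω)]
    · simp
    · intro s _ hs
      simp [hs.symm]
    · exact fun h' => (h' (hω n)).elim
  have hint : ∀ s ∈ A, Integrable ({ω | X n ω = s}.indicator fun _ => f s) P := fun s _ =>
    (integrable_const _).indicator (h.measurableSet_eq n s)
  refine ⟨(integrable_finsetSum A hint).congr hae.symm, ?_⟩
  rw [integral_congr_ae hae, integral_finsetSum A hint]
  refine Finset.sum_congr rfl fun s _ => ?_
  rw [integral_indicator (h.measurableSet_eq n s), setIntegral_const, smul_eq_mul]

theorem integral_pair (h : IsMarkovChain P κ s₀ X) {A : Finset S}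
    (hA : ∀ᵐ ω ∂P, ∀ n, X n ω ∈ A) (n : ℕ) (f : S → S → ℝ) :
    ∫ ω, f (X n ω) (X (n + 1) ω) ∂P =
      ∫ ω, ∑ t ∈ A, (κ (X n ω) t).toReal * f (X n ω) t ∂P := by
  rw [(h.integrable_integral_eq_sum hA n fun s => ∑ t ∈ A, (κ s t).toReal * f s t).2]
  have hae : (fun ω => f (X n ω) (X (n + 1) ω)) =ᵐ[P]
      fun ω => ∑ s ∈ A, ∑ t ∈ A,
        ({ω | X n ω = s} ∩ {ω | X (n + 1) ω = t}).indicator (fun _ => f s t) ω := by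
    filter_upwards [hA] with ω hω
    rw [Finset.sum_eq_single (X n ω), Finset.sum_eq_single (X (n + 1) ω)]
    · simp
    · intro s _ hs
      simp [hs.symm]
    · exact fun h' => (h' (hω _)).elim
    · intro s _ hs
      exact Finset.sum_eq_zero fun t _ => by simp [hs.symm]
    · exact fun h' => (h' (hω n)).elim
  have hm : ∀ s t, MeasurableSet ({ω | X n ω = s} ∩ {ω | X (n + 1) ω = t}) := fun s t =>
    (h.measurableSet_eq n s).inter (h.measurableSet_eq (n + 1) t)
  have hint : ∀ s t, Integrable
      (({ω | X n ω = s} ∩ {ω | X (n + 1) ω = t}).indicator fun _ => f s t) P := fun s t =>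
    (integrable_const _).indicator (hm s t)
  rw [integral_congr_ae hae, integral_finsetSum A fun s _ =>
    integrable_finsetSum A fun t _ => hint s t]
  refine Finset.sum_congr rfl fun s _ => ?_
  rw [integral_finsetSum A fun t _ => hint s t, Finset.mul_sum]
  refine Finset.sum_congr rfl fun t _ => ?_
  rw [integral_indicator (hm s t), setIntegral_const, smul_eq_mul, measureReal_def,
    h.measure_inter_eq, ENNReal.toReal_mul, measureReal_def, mul_assoc]

/-- The generating function of the absorption time of a Markov chain on a finite set is, close to
`1`, the solution of the corresponding linear equations. -/
theorem hittingTime_generatingFunction (h : IsMarkovChain P κ s₀ X) {A : Finset S} (h0 : s₀ ∈ A)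
    (hA : ∀ s ∈ A, ∀ t, κ s t ≠ 0 → t ∈ A) {done : S → Prop}
    (hdone0 : ¬ done s₀) (habs : ∀ s ∈ A, done s → ∀ t, κ s t ≠ 0 → done t)
    {F : ℝ → S → ℝ} (hF1 : ∀ z, ∀ s ∈ A, done s → F z s = 1)
    (hF : ∀ᶠ z in 𝓝 1, ∀ s ∈ A, ¬ done s → F z s = z * ∑ t ∈ A, (κ s t).toReal * F z t)
    (hFc : ∀ s ∈ A, Tendsto (fun z => F z s) (𝓝 1) (𝓝 1)) :
    (∀ᵐ ω ∂P, ∃ k, done (X k ω)) ∧ Measurable (fun ω => sInf {k | done (X k ω)}) ∧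
    ∀ᶠ z in 𝓝 (1 : ℝ), 0 < z ∧
      Integrable (fun ω => z ^ sInf {k | done (X k ω)}) P ∧
      ∫ ω, z ^ sInf {k | done (X k ω)} ∂P = F z s₀ := by
  classical
  set T : Ω → ℕ := fun ω => sInf {k | done (X k ω)} with hT
  have hmem := h.ae_mem (A := (A : Set S)) h0 hA
  simp only [Finset.mem_coe] at hmem
  have hmono : ∀ᵐ ω ∂P, ∀ n, done (X n ω) → done (X (n + 1) ω) := by
    filter_upwards [hmem, h.ae_transition_ne_zero] with ω h1 h2 n hn
    exact habs _ (h1 n) hn _ (h2 n)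
  -- Only positive values are characterized: 0 is also the default value of `sInf` for a run that
  -- never stops.
  have hmonoT : ∀ᵐ ω ∂P, ∀ n, (T ω = n + 1 ↔ ¬ done (X n ω) ∧ done (X (n + 1) ω)) := by
    filter_upwards [hmono] with ω hω n
    constructor
    · intro hTn
      have hne : {k | done (X k ω)}.Nonempty := Nat.nonempty_of_sInf_eq_succ hTn
      refine ⟨fun hd => ?_, ?_⟩
      · have : T ω ≤ n := Nat.sInf_le hd
        omega
      · have := Nat.sInf_mem hne
        rw [show sInf {k | done (X k ω)} = n + 1 from hTn] at this
        exact this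
    · rintro ⟨hn, hn1⟩
      refine le_antisymm (Nat.sInf_le hn1) (Nat.succ_le_of_lt ?_)
      by_contra hle
      push Not at hle
      have hd : done (X (T ω) ω) := Nat.sInf_mem (s := {k | done (X k ω)}) ⟨n + 1, hn1⟩
      have : ∀ m, done (X (T ω + m) ω) := fun m => by
        induction m with
        | zero => exact hd
        | succ m ih => exact hω _ ih
      have h3 := this (n - T ω)
      rw [Nat.add_sub_cancel' hle] at h3
      exact hn h3
  have hmeasdone : ∀ n, MeasurableSet {ω | done (X n ω)} := fun n =>
    h.measurableSet_mem n {s | done s}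
  have hTsucc : ∀ n, MeasurableSet (T ⁻¹' {n + 1}) := by
    intro n
    have : T ⁻¹' {n + 1} = {ω | done (X (n + 1) ω)} ∩ ⋂ j : Fin (n + 1), {ω | done (X j ω)}ᶜ := by
      ext ω
      simp only [Set.mem_preimage, Set.mem_singleton_iff, Set.mem_inter_iff, Set.mem_ofPred_eq,
        Set.mem_iInter, Set.mem_compl_iff]
      constructor
      · intro hTn
        refine ⟨?_, fun j hj => ?_⟩
        · have := Nat.sInf_mem (Nat.nonempty_of_sInf_eq_succ hTn)
          rw [show sInf {k | done (X k ω)} = n + 1 from hTn] at this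
          exact this
        · have : T ω ≤ j := Nat.sInf_le hj
          omega
      · rintro ⟨h1, h2⟩
        refine le_antisymm (Nat.sInf_le h1) ?_
        refine le_csInf ⟨_, h1⟩ fun j hj => ?_
        by_contra hlt
        exact h2 ⟨j, by omega⟩ hj
    rw [this]
    exact (hmeasdone _).inter (MeasurableSet.iInter fun j => (hmeasdone _).compl)
  have hTm : Measurable T := by
    refine measurable_to_countable' fun k => ?_
    cases k with
    | succ n => exact hTsucc n
    | zero =>
      have : T ⁻¹' {0} = (⋃ n, T ⁻¹' {n + 1})ᶜ := by
        ext ω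
        simp only [Set.mem_preimage, Set.mem_singleton_iff, Set.mem_compl_iff, Set.mem_iUnion,
          not_exists]
        constructor
        · intro h n; omega
        · intro h
          by_contra h0
          exact h (T ω - 1) (by omega)
      rw [this]
      exact (MeasurableSet.iUnion hTsucc).compl
  let u : ℝ → ℕ → ℝ := fun z n => ∫ ω, (if done (X n ω) then 0 else F z (X n ω)) ∂P
  let d : ℕ → ℝ := fun k => P.real (T ⁻¹' {k})
  have hd0 : ∀ k, 0 ≤ d k := fun k => measureReal_nonneg
  -- The mass absorbed at time n + 1 enters with F = 1 and is split off as `d (n + 1)`; `u` keeps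
  -- the part not yet absorbed.
  have hstep : ∀ z, (∀ s ∈ A, ¬ done s → F z s = z * ∑ t ∈ A, (κ s t).toReal * F z t) →
      ∀ n, u z n = z * (u z (n + 1) + d (n + 1)) := by
    intro z hz n
    have e1 : u z n = ∫ ω, ∑ t ∈ A, (κ (X n ω) t).toReal *
        (if done (X n ω) then 0 else z * F z t) ∂P := by
      refine integral_congr_ae ?_
      filter_upwards [hmem] with ω hω
      split_ifs with hd
      · simp
      · rw [hz _ (hω n) hd, Finset.mul_sum]
        exact Finset.sum_congr rfl fun t _ => by ring
    rw [e1, ← h.integral_pair hmem n fun s t => if done s then 0 else z * F z t]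
    have e2 : (fun ω => if done (X n ω) then 0 else z * F z (X (n + 1) ω)) =ᵐ[P]
        fun ω => z * ((if done (X (n + 1) ω) then 0 else F z (X (n + 1) ω)) +
          (T ⁻¹' {n + 1}).indicator (fun _ => (1 : ℝ)) ω) := by
      filter_upwards [hmem, hmono, hmonoT] with ω h1 h2 h3
      by_cases hn : done (X n ω)
      · simp [hn, h2 n hn, h3 n]
      · by_cases hn1 : done (X (n + 1) ω)
        · simp [hn, hn1, h3 n, hF1 z _ (h1 (n + 1)) hn1]
        · simp [hn, hn1, h3 n]
    rw [integral_congr_ae e2, integral_const_mul, integral_add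
      (h.integrable_integral_eq_sum hmem (n + 1) fun s => if done s then 0 else F z s).1
      ((integrable_const _).indicator (hTsucc n)), integral_indicator_const _ (hTsucc n)]
    simp [u, d]
  have hu0 : ∀ z, u z 0 = F z s₀ := by
    intro z
    have : (fun ω => if done (X 0 ω) then 0 else F z (X 0 ω)) =ᵐ[P] fun _ => F z s₀ := by
      filter_upwards [h.ae_zero_eq] with ω hω
      rw [hω, if_neg hdone0]
    simp [u, integral_congr_ae this]
  have hsum : ∀ z, (∀ s ∈ A, ¬ done s → F z s = z * ∑ t ∈ A, (κ s t).toReal * F z t) →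
      ∀ n, F z s₀ = ∑ k ∈ Finset.range n, z ^ (k + 1) * d (k + 1) + z ^ n * u z n := by
    intro z hz n
    induction n with
    | zero => simp [hu0]
    | succ n ih => rw [ih, Finset.sum_range_succ, hstep z hz n]; ring
  let r : ℕ → ℝ := fun n => P.real {ω | ¬ done (X n ω)}
  have hub : ∀ z, (∀ s ∈ A, (1 : ℝ) / 2 < F z s ∧ F z s < 2) →
      ∀ n, r n ≤ 2 * u z n ∧ u z n ≤ 2 * r n := by
    intro z hz n
    have hr : r n = ∫ ω, (if done (X n ω) then 0 else (1 : ℝ)) ∂P := by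
      have : (fun ω => if done (X n ω) then 0 else (1 : ℝ)) =
          {ω | ¬ done (X n ω)}.indicator fun _ => 1 := by
        ext ω; by_cases hd : done (X n ω) <;> simp [hd]
      rw [this, integral_indicator_const _
        (show MeasurableSet {ω | ¬ done (X n ω)} from (hmeasdone n).compl)]
      simp [r]
    have i1 := (h.integrable_integral_eq_sum hmem n fun s => if done s then 0 else F z s).1
    have i2 := (h.integrable_integral_eq_sum hmem n fun s => if done s then 0 else (1 : ℝ)).1
    rw [hr, ← integral_const_mul, ← integral_const_mul]
    constructor
    · refine integral_mono_ae i2 (i1.const_mul 2) ?_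
      filter_upwards [hmem] with ω hω
      have := (hz _ (hω n)).1
      split_ifs <;> linarith
    · refine integral_mono_ae i1 (i2.const_mul 2) ?_
      filter_upwards [hmem] with ω hω
      have := (hz _ (hω n)).2
      split_ifs <;> linarith
  have hbound : ∀ᶠ z in 𝓝 (1 : ℝ), ∀ s ∈ A, (1 : ℝ) / 2 < F z s ∧ F z s < 2 := by
    rw [Filter.eventually_all_finset]
    intro s hs
    exact ((hFc s hs).eventually (lt_mem_nhds (by norm_num))).and
      ((hFc s hs).eventually (gt_mem_nhds (by norm_num)))
  -- Some z₁ beyond 1 is still covered by the equations and the bounds. There z₁ ^ n * u z₁ n ≤ F z₁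
  -- s₀ < 2, so the survival probability decays like z₁ ^ (-n).
  obtain ⟨z₁, ⟨hz₁F, hz₁b⟩, hz₁⟩ : ∃ z₁ : ℝ, ((∀ s ∈ A, ¬ done s → F z₁ s =
      z₁ * ∑ t ∈ A, (κ s t).toReal * F z₁ t) ∧
      ∀ s ∈ A, (1 : ℝ) / 2 < F z₁ s ∧ F z₁ s < 2) ∧ 1 < z₁ :=
    ((((hF.and hbound).filter_mono nhdsWithin_le_nhds).and
      (self_mem_nhdsWithin : Set.Ioi (1 : ℝ) ∈ 𝓝[>] 1)).exists)
  have hz₁0 : 0 < z₁ := zero_lt_one.trans hz₁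
  have hr0 : ∀ n, 0 ≤ r n := fun n => measureReal_nonneg
  have hr : ∀ n, r n ≤ 4 / z₁ ^ n := by
    intro n
    have h1 := hsum z₁ hz₁F n
    have h2 := (hub z₁ hz₁b n).1
    have h3 := (hz₁b s₀ h0).2
    have h4 : 0 ≤ ∑ k ∈ Finset.range n, z₁ ^ (k + 1) * d (k + 1) :=
      Finset.sum_nonneg fun k _ => mul_nonneg (pow_pos hz₁0 _).le (hd0 _)
    have hp : 0 < z₁ ^ n := pow_pos hz₁0 n
    rw [le_div_iff₀ hp]
    nlinarith
  have hdone : ∀ᵐ ω ∂P, ∃ k, done (X k ω) := by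
    have hlim : Tendsto r atTop (𝓝 0) := by
      refine squeeze_zero hr0 hr ?_
      have := (tendsto_pow_atTop_atTop_of_one_lt hz₁).const_div_atTop (r := (4 : ℝ))
      exact this
    have hle : ∀ n, P.real {ω | ¬ ∃ k, done (X k ω)} ≤ r n := fun n =>
      measureReal_mono fun ω hω hd => hω ⟨n, hd⟩
    have h0' : P.real {ω | ¬ ∃ k, done (X k ω)} = 0 :=
      le_antisymm (ge_of_tendsto' hlim hle) measureReal_nonneg
    rw [ae_iff]
    exact (measureReal_eq_zero_iff).1 h0'
  refine ⟨hdone, hTm, ?_⟩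
  -- The default value 0 occurs only on the null set of runs that never stop, and the initial state
  -- is not done.
  have hdz : d 0 = 0 := by
    refine (measureReal_eq_zero_iff).2 ?_
    have : ∀ᵐ ω ∂P, T ω ≠ 0 := by
      filter_upwards [h.ae_zero_eq, hdone] with ω h1 h2 hT0
      have := Nat.sInf_mem (s := {k | done (X k ω)}) h2
      rw [show sInf {k | done (X k ω)} = 0 from hT0] at this
      exact hdone0 (h1 ▸ this)
    simpa [ae_iff, Set.preimage] using this
  filter_upwards [hF, hbound, lt_mem_nhds (show (0 : ℝ) < 1 by norm_num), gt_mem_nhds hz₁]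
    with z hzF hzb hz0 hzz
  refine ⟨hz0, ?_⟩
  have hs : HasSum (fun k => z ^ k * d k) (F z s₀) := by
    rw [← hasSum_nat_add_iff' 1]
    simp only [Finset.range_one, Finset.sum_singleton, hdz, mul_zero, sub_zero]
    rw [hasSum_iff_tendsto_nat_of_nonneg
      (fun k => mul_nonneg (pow_pos hz0 _).le (hd0 _))]
    -- The tail obtained at z₁ makes the remainder vanish for every positive z < z₁ near 1.
    have hlim : Tendsto (fun n => z ^ n * u z n) atTop (𝓝 0) := by
      refine squeeze_zero (fun n => ?_) (fun n => ?_)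
        (g := fun n => 8 * (z / z₁) ^ n) ?_
      · have := (hub z hzb n).1
        have := hr0 n
        exact mul_nonneg (pow_pos hz0 _).le (by linarith)
      · have h1 := (hub z hzb n).2
        have h2 := hr n
        calc z ^ n * u z n ≤ z ^ n * (2 * (4 / z₁ ^ n)) :=
              mul_le_mul_of_nonneg_left (by linarith) (pow_pos hz0 _).le
          _ = 8 * (z / z₁) ^ n := by rw [div_pow]; ring
      · have := (tendsto_pow_atTop_nhds_zero_of_lt_one (div_pos hz0 hz₁0).le
          ((div_lt_one hz₁0).2 hzz)).const_mul 8
        simpa using this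
    have : (fun n => ∑ k ∈ Finset.range n, z ^ (k + 1) * d (k + 1)) =
        fun n => F z s₀ - z ^ n * u z n := by
      ext n; rw [hsum z hzF n]; ring
    rw [this]
    simpa using hlim.const_sub (F z s₀)
  have hl : ∫⁻ ω, ENNReal.ofReal (z ^ T ω) ∂P = ENNReal.ofReal (F z s₀) := by
    rw [← hs.tsum_eq, ENNReal.ofReal_tsum_of_nonneg
      (fun k => mul_nonneg (pow_pos hz0 _).le (hd0 _)) hs.summable,
      ← lintegral_map (f := fun k : ℕ => ENNReal.ofReal (z ^ k)) (by fun_prop) hTm,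
      lintegral_countable']
    refine tsum_congr fun k => ?_
    rw [Measure.map_apply hTm (measurableSet_singleton k),
      ENNReal.ofReal_mul (pow_pos hz0 _).le, ofReal_measureReal]
  have hm : Measurable fun ω => z ^ T ω :=
    (measurable_of_countable fun k : ℕ => z ^ k).comp hTm
  have hnn : 0 ≤ᵐ[P] fun ω => z ^ T ω := ae_of_all _ fun ω => (pow_pos hz0 _).le
  constructor
  · refine ⟨hm.aestronglyMeasurable, ?_⟩
    rw [hasFiniteIntegral_iff_ofReal hnn, hl]
    exact ENNReal.ofReal_lt_top
  · rw [integral_eq_lintegral_of_nonneg_ae hnn hm.aestronglyMeasurable, hl,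
      ENNReal.toReal_ofReal]
    have := (hzb s₀ h0).1
    linarith

end ConnectionGraph.IsMarkovChain

/-! ### Diagonalization of a positive diagonal matrix times a Hermitian one. -/

namespace Matrix

variable {V : Type*} [Fintype V] [DecidableEq V]

/-- The product of a positive diagonal matrix and a Hermitian matrix is diagonalizable, with real
eigenvalues. -/
theorem exists_diagonalization_diagonal_mul {d : V → ℝ} (hd : ∀ x, 0 < d x) {H : Matrix V V ℂ}
    (hH : H.IsHermitian) : ∃ (e : V → ℝ) (A B : Matrix V V ℂ), A * B = 1 ∧ B * A = 1 ∧
      Matrix.diagonal (fun x => (d x : ℂ)) * H = A * Matrix.diagonal (fun x => (e x : ℂ)) * B := by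
  set s : Matrix V V ℂ := Matrix.diagonal fun x => ((Real.sqrt (d x) : ℝ) : ℂ) with hs
  set s' : Matrix V V ℂ := Matrix.diagonal fun x => (((Real.sqrt (d x))⁻¹ : ℝ) : ℂ) with hs'
  have hne : ∀ x, Real.sqrt (d x) ≠ 0 := fun x => (Real.sqrt_pos.2 (hd x)).ne'
  have hss : s * s = Matrix.diagonal fun x => (d x : ℂ) := by
    rw [hs, Matrix.diagonal_mul_diagonal]
    congr 1
    ext x
    rw [← Complex.ofReal_mul, Real.mul_self_sqrt (hd x).le]
  have hss' : s * s' = 1 := by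
    rw [hs, hs', Matrix.diagonal_mul_diagonal, ← Matrix.diagonal_one]
    congr 1
    ext x
    rw [← Complex.ofReal_mul, mul_inv_cancel₀ (hne x), Complex.ofReal_one]
  have hs's : s' * s = 1 := mul_eq_one_comm.1 hss'
  -- With s² = D, one has DH = s (sHs) s⁻¹, so the spectral theorem applies after conjugation by s.
  have hN : (s * H * s).IsHermitian := by
    have h : sᴴ = s := by
      rw [hs, Matrix.diagonal_conjTranspose]
      congr 1
      ext x
      simp
    rw [Matrix.IsHermitian, Matrix.conjTranspose_mul, Matrix.conjTranspose_mul, h, hH.eq,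
      Matrix.mul_assoc]
  obtain ⟨e, U, hUU, hsp⟩ : ∃ (e : V → ℝ) (U : Matrix V V ℂ), U * star U = 1 ∧
      s * H * s = U * Matrix.diagonal (fun x => (e x : ℂ)) * star U := by
    refine ⟨hN.eigenvalues, hN.eigenvectorUnitary, Unitary.coe_mul_star_self _, ?_⟩
    have h := hN.spectral_theorem
    rw [Unitary.conjStarAlgAut_apply] at h
    exact h
  refine ⟨e, s * U, star U * s', ?_, ?_, ?_⟩
  · rw [show s * U * (star U * s') = s * (U * star U) * s' by simp only [Matrix.mul_assoc], hUU,
      Matrix.mul_one, hss']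
  · rw [show star U * s' * (s * U) = star U * (s' * s) * U by simp only [Matrix.mul_assoc], hs's,
      Matrix.mul_one, mul_eq_one_comm.1 hUU]
  · have : s * (s * H * s) * s' = Matrix.diagonal (fun x => (d x : ℂ)) * H := by
      rw [← hss, show s * (s * H * s) * s' = s * s * H * (s * s') by
        simp only [Matrix.mul_assoc], hss', Matrix.mul_one]
    rw [← this, hsp]
    simp only [Matrix.mul_assoc]

section

variable {M A B : Matrix V V ℂ} {e : V → ℝ}

theorem one_sub_smul_eq_of_diagonalization (hAB : A * B = 1)
    (hM : M = A * Matrix.diagonal (fun x => (e x : ℂ)) * B) (z : ℝ) :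
    1 - (z : ℂ) • M = A * Matrix.diagonal (fun x => ((1 - z * e x : ℝ) : ℂ)) * B := by
  have h : Matrix.diagonal (fun x => ((1 - z * e x : ℝ) : ℂ)) =
      1 - (z : ℂ) • Matrix.diagonal (fun x => (e x : ℂ)) := by
    ext x y
    by_cases h : x = y
    · subst h; simp
    · simp [h]
  rw [h, Matrix.mul_sub, Matrix.sub_mul, Matrix.mul_one, hAB, Matrix.mul_smul, Matrix.smul_mul,
    ← hM]

theorem det_one_sub_smul_of_diagonalization (hAB : A * B = 1)
    (hM : M = A * Matrix.diagonal (fun x => (e x : ℂ)) * B) (z : ℝ) :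
    (1 - (z : ℂ) • M).det = ((∏ x, (1 - z * e x) : ℝ) : ℂ) := by
  rw [one_sub_smul_eq_of_diagonalization hAB hM, Matrix.det_mul, Matrix.det_mul, mul_right_comm,
    ← Matrix.det_mul, hAB, Matrix.det_one, one_mul, Matrix.det_diagonal, Complex.ofReal_prod]

theorem inv_one_sub_of_diagonalization (hAB : A * B = 1) (hBA : B * A = 1)
    (hM : M = A * Matrix.diagonal (fun x => (e x : ℂ)) * B) (he : ∀ x, 1 - e x ≠ 0) :
    (1 - M)⁻¹ = A * Matrix.diagonal (fun x => (((1 - e x)⁻¹ : ℝ) : ℂ)) * B := by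
  refine Matrix.inv_eq_left_inv ?_
  have h := one_sub_smul_eq_of_diagonalization hAB hM 1
  rw [Complex.ofReal_one, one_smul] at h
  rw [h, show ∀ X Y : Matrix V V ℂ, A * X * B * (A * Y * B) = A * (X * ((B * A) * Y)) * B from
    fun X Y => by simp only [Matrix.mul_assoc], hBA, Matrix.one_mul, Matrix.diagonal_mul_diagonal]
  have : (fun x => (((1 - e x)⁻¹ : ℝ) : ℂ) * ((1 - 1 * e x : ℝ) : ℂ)) = fun _ => 1 := by
    ext x
    rw [← Complex.ofReal_mul, one_mul, inv_mul_cancel₀ (he x), Complex.ofReal_one]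
  rw [this, Matrix.diagonal_one, Matrix.mul_one, hAB]

theorem trace_of_diagonalization (hBA : B * A = 1) (f : V → ℝ) :
    (A * Matrix.diagonal (fun x => (f x : ℂ)) * B).trace = ((∑ x, f x : ℝ) : ℂ) := by
  rw [Matrix.trace_mul_comm, ← Matrix.mul_assoc, hBA, Matrix.one_mul, Matrix.trace_diagonal,
    Complex.ofReal_sum]

theorem mul_of_diagonalization (hBA : B * A = 1) (f g : V → ℝ) :
    A * Matrix.diagonal (fun x => (f x : ℂ)) * B * (A * Matrix.diagonal (fun x => (g x : ℂ)) * B) =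
      A * Matrix.diagonal (fun x => ((f x * g x : ℝ) : ℂ)) * B := by
  rw [show ∀ X Y : Matrix V V ℂ, A * X * B * (A * Y * B) = A * (X * ((B * A) * Y)) * B from
    fun X Y => by simp only [Matrix.mul_assoc], hBA, Matrix.one_mul, Matrix.diagonal_mul_diagonal]
  simp only [Complex.ofReal_mul]

end

end Matrix

/-! ### Mean and variance from the cumulant generating function. -/

namespace ProbabilityTheory

open MeasureTheory Filter Topology

/-- The mean and the variance of a sum of geometric-like terms, from its generating function. -/
theorem moments_of_generatingFunction {Ω V : Type*} [Fintype V] [MeasurableSpace Ω] {P : Measure Ω}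
    [IsProbabilityMeasure P] {T : Ω → ℕ} (e : V → ℝ) (he : ∀ x, 1 - e x ≠ 0)
    (hT : ∀ᶠ z in 𝓝 (1 : ℝ), 0 < z ∧ Integrable (fun ω => z ^ T ω) P ∧
      ∫ ω, z ^ T ω ∂P = z ^ Fintype.card V * (∏ x, (1 - e x)) / ∏ x, (1 - z * e x)) :
    MemLp (fun ω => (T ω : ℝ)) 2 P ∧
    ∫ ω, (T ω : ℝ) ∂P = ∑ x, (1 - e x)⁻¹ ∧
    variance (fun ω => (T ω : ℝ)) P =
      ∑ x, e x * (1 - e x)⁻¹ + ∑ x, (e x * (1 - e x)⁻¹) ^ 2 := by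
  set Y : Ω → ℝ := fun ω => (T ω : ℝ) with hY
  have hexp : Tendsto Real.exp (𝓝 0) (𝓝 1) := by
    simpa using Real.continuous_exp.tendsto 0
  have hpow : ∀ t ω, Real.exp (t * Y ω) = Real.exp t ^ T ω := fun t ω => by
    rw [mul_comm, hY, ← Real.exp_nat_mul]
  have hT' := hexp.eventually hT
  have hint : (0 : ℝ) ∈ interior (integrableExpSet Y P) := by
    rw [mem_interior_iff_mem_nhds]
    filter_upwards [hT'] with t ht
    have := ht.2.1
    simp only [← hpow] at this
    exact this
  have hne : ∀ᶠ t in 𝓝 (0 : ℝ), ∀ x, 1 - Real.exp t * e x ≠ 0 := by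
    rw [eventually_all]
    intro x
    have hc : Continuous fun t => 1 - Real.exp t * e x := by fun_prop
    exact hc.continuousAt.eventually_ne (by simpa using he x)
  have hcgf : cgf Y P =ᶠ[𝓝 0] fun t => Fintype.card V * t + ∑ x, Real.log (1 - e x) -
      ∑ x, Real.log (1 - Real.exp t * e x) := by
    filter_upwards [hT', hne] with t ht hn
    have h1 : mgf Y P t = Real.exp t ^ Fintype.card V * (∏ x, (1 - e x)) /
        ∏ x, (1 - Real.exp t * e x) := by
      rw [← ht.2.2, mgf]
      simp only [hpow]
    have hp1 : ∏ x, (1 - e x) ≠ 0 := Finset.prod_ne_zero_iff.2 fun x _ => he x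
    have hp2 : ∏ x, (1 - Real.exp t * e x) ≠ 0 := Finset.prod_ne_zero_iff.2 fun x _ => hn x
    -- `Real.log` is the logarithm of the absolute value, so the factors need only be nonzero; no
    -- sign of 1 - e x is required.
    rw [cgf, h1, Real.log_div (mul_ne_zero (pow_ne_zero _ (Real.exp_pos t).ne') hp1) hp2,
      Real.log_mul (pow_ne_zero _ (Real.exp_pos t).ne') hp1, Real.log_pow, Real.log_exp,
      Real.log_prod fun x _ => he x, Real.log_prod fun x _ => hn x]
  have hderiv : deriv (cgf Y P) =ᶠ[𝓝 0] fun t => Fintype.card V +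
      ∑ x, Real.exp t * e x / (1 - Real.exp t * e x) := by
    have := hcgf.deriv
    filter_upwards [this, hne] with t ht hn
    rw [ht]
    have hd : ∀ x ∈ Finset.univ, HasDerivAt (fun t => Real.log (1 - Real.exp t * e x))
        (-(Real.exp t * e x) / (1 - Real.exp t * e x)) t := fun x _ =>
      (((Real.hasDerivAt_exp t).mul_const (e x)).const_sub 1).log (hn x)
    have h1 := (((hasDerivAt_id t).const_mul (Fintype.card V : ℝ)).add_const
      (∑ x, Real.log (1 - e x))).sub (HasDerivAt.fun_sum hd)
    refine h1.deriv.trans ?_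
    simp only [neg_div, Finset.sum_neg_distrib, sub_neg_eq_add, mul_one]
  have hmem : MemLp Y 2 P := memLp_of_mem_interior_integrableExpSet hint 2
  have hmean : ∫ ω, Y ω ∂P = ∑ x, (1 - e x)⁻¹ := by
    have h1 := deriv_cgf_zero hint
    rw [probReal_univ, div_one, hderiv.eq_of_nhds] at h1
    rw [← h1, Real.exp_zero]
    -- The n kept steps are shared out, one per eigenvalue: 1 + e/(1 - e) = 1/(1 - e).
    have : (Fintype.card V : ℝ) = ∑ _x : V, (1 : ℝ) := by simp
    rw [this, ← Finset.sum_add_distrib]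
    refine Finset.sum_congr rfl fun x _ => ?_
    have := he x
    rw [one_mul]
    field_simp
    ring
  refine ⟨hmem, hmean, ?_⟩
  have h2 := iteratedDeriv_two_cgf_eq_integral hint
  have hd0 : deriv (cgf Y P) 0 = ∫ ω, Y ω ∂P := by
    rw [deriv_cgf_zero hint, probReal_univ, div_one]
  simp only [hd0, zero_mul, Real.exp_zero, mul_one, mgf_zero, div_one] at h2
  rw [variance_eq_integral hmem.1.aemeasurable, ← h2, iteratedDeriv_succ, iteratedDeriv_one,
    hderiv.deriv_eq, ← Finset.sum_add_distrib]
  have hd : ∀ x ∈ Finset.univ, HasDerivAt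
      (fun t => Real.exp t * e x / (1 - Real.exp t * e x))
      ((Real.exp 0 * e x * (1 - Real.exp 0 * e x) - Real.exp 0 * e x * (-(Real.exp 0 * e x))) /
        (1 - Real.exp 0 * e x) ^ 2) 0 := fun x _ =>
    HasDerivAt.fun_div ((Real.hasDerivAt_exp 0).mul_const (e x))
      (((Real.hasDerivAt_exp 0).mul_const (e x)).const_sub 1) (by simpa using he x)
  refine ((HasDerivAt.fun_sum hd).const_add (Fintype.card V : ℝ)).deriv.trans ?_
  refine Finset.sum_congr rfl fun x _ => ?_
  have := he x
  rw [Real.exp_zero, one_mul]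
  field_simp
  ring

end ProbabilityTheory

/-! ### Application to the running time, and the trace formulas. -/

namespace ConnectionGraph

open MeasureTheory Filter Topology

variable {V : Type*} [Fintype V] [DecidableEq V]

theorem popDet_univ (G : ConnectionGraph V) {q : ℝ} (hq : 0 < q) (z : ℝ) :
    (G.popDet q z Finset.univ : ℂ) = (1 - (z : ℂ) • G.M q).det := by
  rw [coe_popDet G hq, popMatrix, Matrix.rowRestrict_univ]

theorem Δ_add_smul_one (G : ConnectionGraph V) {q : ℝ} (hq : 0 < q) :
    G.Δ + (q : ℂ) • (1 : Matrix V V ℂ) =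
      (G.D + (q : ℂ) • (1 : Matrix V V ℂ)) * (1 - G.M q) := by
  rw [M, Matrix.mul_sub, Matrix.mul_one, Matrix.mul_nonsing_inv_cancel_left _ _
    ((Matrix.isUnit_iff_isUnit_det _).1 (G.isUnit_D_add_smul_one hq)), Δ]
  abel

/-- The generating function of the running time. -/
theorem runningTime_generatingFunction {Ω : Type*} [MeasurableSpace Ω] {P : Measure Ω}
    [IsProbabilityMeasure P] (G : ConnectionGraph V) (hweak : G.WeaklyInconsistent)
    {q : ℝ} (hq : 0 < q) (ι : Fin (Fintype.card V) ≃ V) {X : ℕ → Ω → State V}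
    (hX : IsCyclePoppingRun P G q hq ι X) :
    (∀ᵐ ω ∂P, ∃ k, (X k ω).IsDone) ∧
    ∀ᶠ z in 𝓝 (1 : ℝ), 0 < z ∧ Integrable (fun ω => z ^ runningTime X ω) P ∧
      ∫ ω, z ^ runningTime X ω ∂P = G.startValue q z Finset.univ := by
  classical
  have hA : ∀ s, s ∈ (State.finite_setOf_isGood G).toFinset ↔ s.IsGood G := fun s => by simp
  have hunv : unvisited ({none} : Finset (Option V)) = Finset.univ := by ext; simp
  have h0 : (init ι : State V).IsGood G := isGood_start G ι (by simp) _
  have hz : ∀ᶠ z in 𝓝 (1 : ℝ), ∀ S, G.popDet q z S ≠ 0 := by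
    rw [eventually_all]
    exact fun S => (G.continuous_popDet q S).continuousAt.eventually_ne
      (G.popDet_one_ne_zero hq S)
  have key := IsMarkovChain.hittingTime_generatingFunction (done := State.IsDone)
    (F := G.stateValue q) hX ((hA _).2 h0)
    (fun s hs t ht => (hA t).2 (G.isGood_of_step_ne_zero hq ι ((hA s).1 hs) ht))
    (fun hd => by
      obtain ⟨v⟩ := G.connected.nonempty
      have := hd (some v)
      simp [init, start] at this)
    (fun s hs hd t ht => by
      rw [G.step_of_path_eq_nil hq ι (((hA s).1 hs).path_eq_nil hd), ← PMF.mem_support_iff,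
        PMF.support_pure, Set.mem_singleton_iff] at ht
      exact ht ▸ hd)
    (fun z s hs hd => G.stateValue_of_path_eq_nil q z (((hA s).1 hs).path_eq_nil hd))
    (by
      filter_upwards [hz] with z hz s hs hd
      exact G.stateValue_step hweak hq ι hz hA ((hA s).1 hs) hd)
    (fun s _ => by
      have := (G.continuousAt_pathValue hq (unvisited s.nodes) s.path.reverse
        (s.path.getLast?.getD (Classical.choice G.connected.nonempty))).tendsto
      rwa [G.pathValue_one hq] at this)
  refine ⟨key.1, ?_⟩
  filter_upwards [key.2.2] with z h
  rw [init, stateValue_start, hunv] at h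
  exact h

end ConnectionGraph

theorem proposition4p4 {V Ω : Type*} [Fintype V] [DecidableEq V] [MeasurableSpace Ω]
    (P : MeasureTheory.Measure Ω) [MeasureTheory.IsProbabilityMeasure P]
    (G : ConnectionGraph V) (hG : G.NonTrivial) (hweak : G.WeaklyInconsistent)
    (q : ℝ) (hq : 0 < q) (ι : Fin (Fintype.card V) ≃ V)
    (X : ℕ → Ω → ConnectionGraph.State V)
    (hX : ConnectionGraph.IsCyclePoppingRun P G q hq ι X) :
    -- the algorithm stops almost surely, and its running time has a finite second moment
    (∀ᵐ ω ∂P, ∃ k, (X k ω).IsDone) ∧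
    MeasureTheory.MemLp (fun ω => (ConnectionGraph.runningTime X ω : ℝ)) 2 P ∧
    -- the inverses below are genuine
    IsUnit (G.Δ + (q : ℂ) • (1 : Matrix V V ℂ)) ∧
    IsUnit (G.D + (q : ℂ) • (1 : Matrix V V ℂ)) ∧
    IsUnit (1 - G.M q) ∧
    -- the mean
    ((∫ ω, (ConnectionGraph.runningTime X ω : ℝ) ∂P : ℝ) : ℂ) =
      Matrix.trace ((G.D + (q : ℂ) • (1 : Matrix V V ℂ)) *
        (G.Δ + (q : ℂ) • (1 : Matrix V V ℂ))⁻¹) ∧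
    -- the variance
    ((ProbabilityTheory.variance (fun ω => (ConnectionGraph.runningTime X ω : ℝ)) P : ℝ) : ℂ) =
      Matrix.trace (G.M q * (1 - G.M q)⁻¹) +
        Matrix.trace ((G.M q * (1 - G.M q)⁻¹) ^ 2) := by
  obtain ⟨hdone, hgf⟩ := G.runningTime_generatingFunction hweak hq ι hX
  obtain ⟨e, A, B, hAB, hBA, hM⟩ := Matrix.exists_diagonalization_diagonal_mul
    (d := fun x => (G.deg x + q)⁻¹) (fun x => inv_pos.2 (G.deg_add_pos hq x))
    G.isHermitian_W_hadamard_Φ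
  rw [← G.inv_D_add_smul_one hq, ← ConnectionGraph.M] at hM
  -- Both determinants in `startValue` become products over the real eigenvalues of M.
  have hdet : ∀ z, G.popDet q z Finset.univ = ∏ x, (1 - z * e x) := fun z => by
    have h := G.popDet_univ hq z
    rw [Matrix.det_one_sub_smul_of_diagonalization hAB hM] at h
    exact_mod_cast h
  have hdet1 : G.popDet q 1 Finset.univ = ∏ x, (1 - e x) := by simpa using hdet 1
  have he : ∀ x, 1 - e x ≠ 0 := by
    have h := G.popDet_one_ne_zero hq Finset.univ
    rw [hdet1, Finset.prod_ne_zero_iff] at h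
    exact fun x => h x (Finset.mem_univ x)
  have hD := G.isUnit_D_add_smul_one hq
  have h1M : IsUnit (1 - G.M q) := by
    have h := G.popDet_univ hq 1
    rw [Complex.ofReal_one, one_smul] at h
    rw [Matrix.isUnit_iff_isUnit_det, ← h, isUnit_iff_ne_zero, Complex.ofReal_ne_zero]
    exact G.popDet_one_ne_zero hq _
  have hmom := ProbabilityTheory.moments_of_generatingFunction (P := P)
    (T := ConnectionGraph.runningTime X) e he (by
    filter_upwards [hgf] with z hz
    rw [ConnectionGraph.startValue, hdet1, hdet z, Finset.card_univ] at hz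
    exact hz)
  have hinv := Matrix.inv_one_sub_of_diagonalization hAB hBA hM he
  have hMinv : G.M q * (1 - G.M q)⁻¹ =
      A * Matrix.diagonal (fun x => ((e x * (1 - e x)⁻¹ : ℝ) : ℂ)) * B := by
    rw [hinv, ← Matrix.mul_of_diagonalization hBA, ← hM]
  refine ⟨hdone, hmom.1, ?_, hD, h1M, ?_, ?_⟩
  · rw [G.Δ_add_smul_one hq]
    exact hD.mul h1M
  -- Since Δ + qI = (D + qI)(I - M), the matrix under the trace is (I - M)⁻¹ conjugated by D + qI.
  · rw [hmom.2.1, G.Δ_add_smul_one hq, Matrix.mul_inv_rev, Matrix.trace_mul_comm,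
      Matrix.nonsing_inv_mul_cancel_right _ _ ((Matrix.isUnit_iff_isUnit_det _).1 hD), hinv,
      Matrix.trace_of_diagonalization hBA]
  · rw [hmom.2.2, pow_two, hMinv, Matrix.mul_of_diagonalization hBA,
      Matrix.trace_of_diagonalization hBA, Matrix.trace_of_diagonalization hBA]
    push_cast
    simp only [pow_two]
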